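/- **Theorem 4.2.** Let $0\le c<1$ and $p^0(\zeta)=6(1-c^2)\,\mathrm{sech}^2(\sqrt{1-c^2}\,\zeta)$. For $\mathrm{Re}\,\lambda>0$ write the equation $(\lambda-c\frac{d}{d\zeta})^2w=w''-w''''-(p^0w)''$ as a first-order system $\mathbf y'=\mathcal M(\lambda,\zeta)\mathbf y$ for $\mathbf y=(w,w',w'',w''')^T$, and let $\mathcal M^\wedge(\lambda,\zeta)$ be the $6\times6$ matrix which $\mathcal M(\lambda,\zeta)$ induces on $\Lambda^2\mathbb C^4$ (basis $1\wedge2,1\wedge3,1\wedge4,2\wedge3,2\wedge4,3\wedge4$). Let $\mathcal M_\infty(\lambda)$ and $\mathcal M^\wedge_\infty(\lambda)$ be their limits as $\zeta\to\pm\infty$, let $\mu_1(\lambda),\mu_3(\lambda)$ be the eigenvalues of $\mathcal M_\infty(\lambda)$ in the open left half-plane, counted with multiplicity, and let $\mu^\wedge=\mu_1+\mu_3$, which is the eigenvalue of $\mathcal M^\wedge_\infty(\lambda)$ with the least real part. Let $\mathbf r^\wedge(\lambda)$ and $\mathbf l^\wedge(\lambda)$ be right and left eigenvectors of $\mathcal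 M^\wedge_\infty(\lambda)$ for $\mu^\wedge(\lambda)$, normalized in any way, and let $\mathbf y^\wedge$, $\mathbf z^\wedge$ be the solutions on $\mathbb R$ of $$\mathbf y^{\wedge\prime}=\mathcal M^\wedge\mathbf y^\wedge,\quad \lim_{\zeta\to+\infty}e^{-\mu^\wedge\zeta}\mathbf y^\wedge=\mathbf r^\wedge,\qquad \mathbf z^{\wedge\prime}=-\mathbf z^\wedge\mathcal M^\wedge,\quad \lim_{\zeta\to-\infty}e^{\mu^\wedge\zeta}\mathbf z^\wedge=\mathbf l^\wedge .$$ Let $\hat D(\lambda)=\mathbf z^\wedge(\lambda,\zeta)\cdot\mathbf y^\wedge(\lambda,\zeta)$ (independent of $\zeta$) be the unnormalized Evans function. Then $\hat D(\lambda)$ is asymptotic to $\mathbf l^\wedge(\lambda)\cdot\mathbf r^\wedge(\lambda)$ as $|\lambda|\to\infty$, $\mathrm{Re}\,\lambda>0$: $$\frac{\hat D(\lambda)}{\mathbf l^\wedge(\lambda)\cdot\mathbf r^\wedge(\lambda)}\to1 .$$ If moreover the eigenvectors are normalized so that $\mathbf l^\wedge(\lambda)\cdot\mathbf r^\wedge(\lambda)$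 is bounded for large $|\lambda|$ (for instance equal to $1$), then also $\hat D(\lambda)-\mathbf l^\wedge(\lambda)\cdot\mathbf r^\wedge(\lambda)\to0$. -/

import Mathlib

open Filter Topology Matrix

noncomputable section

namespace ElasticaLoop

/-- The tension profile `p⁰(ζ) = 6 (1 - c²) sech² (√(1 - c²) ζ)` of the solitary wave of speed `c`. -/
def p0 (c ζ : ℝ) : ℝ :=
  6 * (1 - c ^ 2) / Real.cosh (Real.sqrt (1 - c ^ 2) * ζ) ^ 2

/-- The limit `𝓜_∞(λ)`, as `ζ → ±∞`, of the matrix `𝓜(λ, ζ)` of the first-order system `y' = 𝓜 y`,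
`y = (w, w', w'', w''')`, equivalent to the linearized equation
`(λ - c d/dζ)² w = w'' - w'''' - (p⁰ w)''`. -/
def MInf (c : ℝ) (lam : ℂ) : Matrix (Fin 4) (Fin 4) ℂ :=
  !![0, 1, 0, 0;
     0, 0, 1, 0;
     0, 0, 0, 1;
     -lam ^ 2, 2 * lam * c, 1 - (c : ℂ) ^ 2, 0]

/-- The matrix that `𝓜(λ, ζ)` induces on the second exterior power of `ℂ⁴`, in the basis
`1∧2, 1∧3, 1∧4, 2∧3, 2∧4, 3∧4`, as a function of the values `p`, `p'`, `p''` of the profile and of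
its first two derivatives. -/
def wedgeMatrix (c : ℝ) (lam p p' p'' : ℂ) : Matrix (Fin 6) (Fin 6) ℂ :=
  !![0, 1, 0, 0, 0, 0;
     0, 0, 1, 1, 0, 0;
     2 * lam * c - 2 * p', 1 - (c : ℂ) ^ 2 - p, 0, 0, 1, 0;
     0, 0, 0, 0, 1, 0;
     lam ^ 2 + p'', 0, 0, 1 - (c : ℂ) ^ 2 - p, 0, 1;
     0, lam ^ 2 + p'', 0, -2 * lam * c + 2 * p', 0, 0]

/-- `𝓜^∧(λ, ζ)`. -/
def MWedge (c : ℝ) (lam : ℂ) (ζ : ℝ) : Matrix (Fin 6) (Fin 6) ℂ :=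
  wedgeMatrix c lam (p0 c ζ : ℝ) (deriv (p0 c) ζ : ℝ) (deriv (deriv (p0 c)) ζ : ℝ)

/-- `𝓜^∧_∞(λ)`, the limit of `𝓜^∧(λ, ζ)` as `ζ → ±∞`. -/
def MWedgeInf (c : ℝ) (lam : ℂ) : Matrix (Fin 6) (Fin 6) ℂ :=
  wedgeMatrix c lam 0 0 0

/-- `μ^∧(λ) = μ₁(λ) + μ₃(λ)`, the sum, with multiplicity, of the eigenvalues of `𝓜_∞(λ)` in the
open left half-plane. -/
def muWedge (c : ℝ) (lam : ℂ) : ℂ :=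
  ((MInf c lam).charpoly.roots.filter (fun μ => μ.re < 0)).sum

/-- `r` is a right eigenvector of `𝓜^∧_∞(λ)` for `μ^∧(λ)`. -/
def IsRightEigenvector (c : ℝ) (lam : ℂ) (r : Fin 6 → ℂ) : Prop :=
  r ≠ 0 ∧ MWedgeInf c lam *ᵥ r = muWedge c lam • r

/-- `l` is a left eigenvector of `𝓜^∧_∞(λ)` for `μ^∧(λ)`. -/
def IsLeftEigenvector (c : ℝ) (lam : ℂ) (l : Fin 6 → ℂ) : Prop :=
  l ≠ 0 ∧ l ᵥ* MWedgeInf c lam = muWedge c lam • l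

/-- `y' = 𝓜^∧ y` on the whole line, and `exp (-μ^∧ ζ) y(ζ) → r` as `ζ → +∞`. -/
def IsYWedge (c : ℝ) (lam : ℂ) (r : Fin 6 → ℂ) (y : ℝ → Fin 6 → ℂ) : Prop :=
  (∀ ζ, HasDerivAt y (MWedge c lam ζ *ᵥ y ζ) ζ) ∧
    Tendsto (fun ζ : ℝ => Complex.exp (-(muWedge c lam * ζ)) • y ζ) atTop (𝓝 r)

/-- `z' = -z 𝓜^∧` on the whole line, and `exp (μ^∧ ζ) z(ζ) → l` as `ζ → -∞`. -/
def IsZWedge (c : ℝ) (lam : ℂ) (l : Fin 6 → ℂ) (z : ℝ → Fin 6 → ℂ) : Prop :=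
  (∀ ζ, HasDerivAt z (-(z ζ ᵥ* MWedge c lam ζ)) ζ) ∧
    Tendsto (fun ζ : ℝ => Complex.exp (muWedge c lam * ζ) • z ζ) atBot (𝓝 l)

open Classical in
/-- The solution `y^∧(λ, ·)` with asymptotics `r` at `+∞`. For `Re λ > 0` and a right eigenvector
`r` it exists and is unique, as `μ^∧` is the eigenvalue of least real part. -/
def yWedge (c : ℝ) (lam : ℂ) (r : Fin 6 → ℂ) : ℝ → Fin 6 → ℂ :=
  if h : ∃ y, IsYWedge c lam r y then h.choose else 0

open Classical in
/-- The solution `z^∧(λ, ·)` with asymptotics `l` at `-∞`. For `Re λ > 0` and a left eigenvector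
`l` it exists and is unique. -/
def zWedge (c : ℝ) (lam : ℂ) (l : Fin 6 → ℂ) : ℝ → Fin 6 → ℂ :=
  if h : ∃ z, IsZWedge c lam l z then h.choose else 0

/-- The product `z · y` of solutions of the two equations does not depend on `ζ`. -/
theorem dotProduct_eq_of_isWedge {c : ℝ} {lam : ℂ} {l r : Fin 6 → ℂ} {y z : ℝ → Fin 6 → ℂ}
    (hy : IsYWedge c lam r y) (hz : IsZWedge c lam l z) (ζ ζ' : ℝ) :
    z ζ ⬝ᵥ y ζ = z ζ' ⬝ᵥ y ζ' := by
  have key : ∀ x, HasDerivAt (fun t => z t ⬝ᵥ y t) 0 x := by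
    intro x
    have h1 := hasDerivAt_pi.1 (hy.1 x)
    have h2 := hasDerivAt_pi.1 (hz.1 x)
    have h : HasDerivAt (fun t => z t ⬝ᵥ y t)
        (∑ i, ((-(z x ᵥ* MWedge c lam x)) i * y x i + z x i * (MWedge c lam x *ᵥ y x) i)) x := by
      simp only [dotProduct]
      exact HasDerivAt.fun_sum fun i _ => (h2 i).mul (h1 i)
    have e : (∑ i, ((-(z x ᵥ* MWedge c lam x)) i * y x i + z x i * (MWedge c lam x *ᵥ y x) i))
        = -(z x ᵥ* MWedge c lam x) ⬝ᵥ y x + z x ⬝ᵥ (MWedge c lam x *ᵥ y x) := by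
      simp only [dotProduct, Finset.sum_add_distrib]
    rw [e, neg_dotProduct, dotProduct_mulVec, neg_add_cancel] at h
    exact h
  exact is_const_of_deriv_eq_zero (fun x => (key x).differentiableAt) (fun x => (key x).deriv) ζ ζ'

/-- The unnormalized Evans function `D̂(λ) = z^∧(λ, ζ) · y^∧(λ, ζ)` belonging to the eigenvectors
`l`, `r`. The product does not depend on `ζ`, and is read off at `ζ = 0`. -/
def evansHat (c : ℝ) (lam : ℂ) (l r : Fin 6 → ℂ) : ℂ :=
  zWedge c lam l 0 ⬝ᵥ yWedge c lam r 0

/-- The filter of `|λ| → ∞` within the open right half-plane `Re λ > 0`. -/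
def atInftyRight : Filter ℂ :=
  Bornology.cobounded ℂ ⊓ 𝓟 {lam : ℂ | 0 < lam.re}

end ElasticaLoop

end

/-!
With `κ = |λ|^{1/2}`, the eigenvalues of `𝓜_∞(λ)` are of size `κ`: at leading order they are the four
roots of `μ⁴ = -λ²`, and they stay separated on that scale, because the derivative of the
characteristic polynomial at a root is at least `κ³` (`le_norm_charDeriv`). Products `vᵢ ∧ vⱼ` of
eigenvectors of `𝓜_∞(λ)` therefore form an eigenbasis of `𝓜^∧_∞(λ)`, with eigenvalues `ρᵢ + ρⱼ` and an
explicit inverse made of the left eigenvectors, and in this basis the perturbation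
`𝓜^∧(λ, ζ) - 𝓜^∧_∞(λ)` is bounded by a constant multiple of `κ⁻¹ (1 + (1 - c²) ζ²)⁻¹`, whose integral
tends to `0` (`IsRootList.norm_coord_perturbation_le`).

The spectral gap of `μ^∧` is not uniform: as `arg λ → ± π / 2`, two eigenvalues of `𝓜_∞(λ)` have real
parts that are small compared with `κ`. A gap is not needed. In the eigenbasis, the unperturbed flow
relative to `exp (μ^∧ ζ)`, run backwards from `+∞`, does not increase norms as soon as
`Re μ^∧ ≤ Re (ρᵢ + ρⱼ)` for all pairs (`IsRootList.re_muWedge_le`), so the fixed point equation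
`u(ζ) = a - ∫_ζ^∞ exp (ν (ζ - s)) B(s) u(s) ds` gives existence of the solution on the whole line
(`exists_solution_tendsto`) and shows that its value at `0` differs from the unperturbed one by a
relative error `O(κ⁻¹)` (`norm_solution_zero_sub_le`). The equation for `z^∧` is of the same kind after
reflection and transposition (`isZWedge_iff_comp_neg`).

Relative errors of `y^∧(0)` and `z^∧(0)` turn into a relative error of the product because `l^∧` and
`r^∧` are multiples of dual basis vectors: `μ^∧` is a simple eigenvalue
(`IsRootList.eq_of_pairSum_eq_muWedge`). This yields
`|D̂ - l^∧ · r^∧| ≤ K κ⁻¹ |l^∧ · r^∧|` (`exists_norm_evansHat_sub_le`), and both limits follow.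
-/

namespace ElasticaLoop

open MeasureTheory Set

/-! ### The scalar equation integrated from infinity -/

/-- The solution `ζ ↦ ∫_{s > ζ} exp (ν (ζ - s)) h s` of `J' = ν J - h` that vanishes at `+∞`. -/
noncomputable def tailDuhamel (ν : ℂ) (h : ℝ → ℂ) (ζ : ℝ) : ℂ :=
  ∫ s in Ioi ζ, Complex.exp (ν * ((ζ - s : ℝ) : ℂ)) * h s

theorem norm_cexp_mul_ofReal_le_one {ν : ℂ} (hν : 0 ≤ ν.re) {t : ℝ} (ht : t ≤ 0) :
    ‖Complex.exp (ν * (t : ℂ))‖ ≤ 1 := by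
  rw [Complex.norm_exp, Complex.re_mul_ofReal]
  exact Real.exp_le_one_iff.2 (mul_nonpos_of_nonneg_of_nonpos hν ht)

theorem hasDerivAt_cexp_mul_ofReal (μ : ℂ) (ζ : ℝ) :
    HasDerivAt (fun x : ℝ => Complex.exp (μ * (x : ℂ))) (Complex.exp (μ * (ζ : ℂ)) * μ) ζ := by
  have := ((Complex.ofRealCLM.hasDerivAt (x := ζ)).const_mul μ).cexp
  simpa using this

theorem integrableOn_Ioi_of_continuous {E : Type*} [NormedAddCommGroup E] {h : ℝ → E} {a : ℝ}
    (hc : Continuous h) (hi : IntegrableOn h (Ioi a)) (b : ℝ) : IntegrableOn h (Ioi b) := by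
  have h1 : IntegrableOn h (Icc b a) := hc.continuousOn.integrableOn_compact isCompact_Icc
  refine (h1.union hi).mono_set fun x hx => ?_
  rcases le_or_gt x a with h | h
  · exact Or.inl ⟨le_of_lt hx, h⟩
  · exact Or.inr h

theorem integrableOn_tailDuhamel {ν : ℂ} (hν : 0 ≤ ν.re) {h : ℝ → ℂ} {ζ : ℝ}
    (hi : IntegrableOn h (Ioi ζ)) :
    IntegrableOn (fun s => Complex.exp (ν * ((ζ - s : ℝ) : ℂ)) * h s) (Ioi ζ) := by
  refine Integrable.bdd_mul hi (c := 1) (Continuous.aestronglyMeasurable (by fun_prop)) ?_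
  filter_upwards [ae_restrict_mem measurableSet_Ioi] with s hs
  exact norm_cexp_mul_ofReal_le_one hν (sub_nonpos.2 (le_of_lt hs))

/-- The kernel has norm at most `1`, as `Re ν ≥ 0` and `ζ - s ≤ 0`. -/
theorem norm_tailDuhamel_le {ν : ℂ} (hν : 0 ≤ ν.re) {h : ℝ → ℂ} {ζ : ℝ} {g : ℝ → ℝ}
    (hg : IntegrableOn g (Ioi ζ)) (hhg : ∀ s, ζ < s → ‖h s‖ ≤ g s) :
    ‖tailDuhamel ν h ζ‖ ≤ ∫ s in Ioi ζ, g s := by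
  refine norm_integral_le_of_norm_le hg ?_
  filter_upwards [ae_restrict_mem measurableSet_Ioi] with s hs
  rw [norm_mul]
  calc _ ≤ 1 * ‖h s‖ := by
        gcongr
        exact norm_cexp_mul_ofReal_le_one hν (sub_nonpos.2 (le_of_lt hs))
    _ ≤ g s := by rw [one_mul]; exact hhg s hs

theorem tailDuhamel_sub {ν : ℂ} (hν : 0 ≤ ν.re) {h₁ h₂ : ℝ → ℂ} {ζ : ℝ}
    (hi₁ : IntegrableOn h₁ (Ioi ζ)) (hi₂ : IntegrableOn h₂ (Ioi ζ)) :
    tailDuhamel ν h₁ ζ - tailDuhamel ν h₂ ζ = tailDuhamel ν (fun s => h₁ s - h₂ s) ζ := by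
  simp only [tailDuhamel, mul_sub]
  exact (integral_sub (integrableOn_tailDuhamel hν hi₁) (integrableOn_tailDuhamel hν hi₂)).symm

theorem hasDerivAt_tailDuhamel {ν : ℂ} (hν : 0 ≤ ν.re) {h : ℝ → ℂ} (hc : Continuous h) {a : ℝ}
    (hi : IntegrableOn h (Ioi a)) (ζ : ℝ) :
    HasDerivAt (tailDuhamel ν h) (ν * tailDuhamel ν h ζ - h ζ) ζ := by
  -- Factor `exp (ν ζ)` out, so that `ζ` is left in the limit of integration only.
  set F : ℝ → ℂ := fun s => Complex.exp (ν * ((0 - s : ℝ) : ℂ)) * h s with hF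
  have hFc : Continuous F := by fun_prop
  have hF0 : IntegrableOn F (Ioi 0) :=
    integrableOn_tailDuhamel hν (integrableOn_Ioi_of_continuous hc hi 0)
  have hrep : tailDuhamel ν h = fun x : ℝ =>
      Complex.exp (ν * (x : ℂ)) * ((∫ s in Ioi 0, F s) - ∫ s in (0 : ℝ)..x, F s) := by
    funext x
    rw [← intervalIntegral.integral_interval_add_Ioi hF0
      (integrableOn_Ioi_of_continuous hFc hF0 x), add_sub_cancel_left, ← integral_const_mul]
    refine integral_congr_ae (Eventually.of_forall fun s => ?_)
    simp only [hF, ← mul_assoc, ← Complex.exp_add]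
    congr 2
    push_cast
    ring
  have h1 := hasDerivAt_cexp_mul_ofReal ν ζ
  have h2 : HasDerivAt (fun x : ℝ => (∫ s in Ioi 0, F s) - ∫ s in (0 : ℝ)..x, F s) (-F ζ) ζ :=
    (intervalIntegral.integral_hasDerivAt_right (hFc.intervalIntegrable _ _)
      (hFc.stronglyMeasurableAtFilter _ _) hFc.continuousAt).const_sub _
  have h3 := h1.mul h2
  rw [hrep]
  refine h3.congr_deriv ?_
  have e : Complex.exp (ν * (ζ : ℂ)) * F ζ = h ζ := by
    simp only [hF, ← mul_assoc, ← Complex.exp_add]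
    rw [show ν * (ζ : ℂ) + ν * ((0 - ζ : ℝ) : ℂ) = 0 by push_cast; ring]
    simp
  linear_combination -e

/-! ### Integrable perturbations of a diagonal system -/

section System

variable {ι : Type*} [Fintype ι] {ν : ι → ℂ} {B : ℝ → Matrix ι ι ℂ} {b : ℝ → ℝ} {a : ι → ℂ}

theorem continuous_mulVec_apply (hB : Continuous B) {u : ℝ → ι → ℂ} (hu : Continuous u) (k : ι) :
    Continuous fun s => (B s *ᵥ u s) k :=
  (continuous_apply k).comp (hB.matrix_mulVec hu)

theorem norm_mulVec_apply_le (hBb : ∀ s (u : ι → ℂ), ‖B s *ᵥ u‖ ≤ b s * ‖u‖) (s : ℝ) (u : ι → ℂ)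
    (k : ι) : ‖(B s *ᵥ u) k‖ ≤ b s * ‖u‖ :=
  (norm_le_pi_norm _ k).trans (hBb s u)

theorem integrableOn_mulVec_apply (hB : Continuous B) (hb : Integrable b) (hb0 : ∀ s, 0 ≤ b s)
    (hBb : ∀ s (u : ι → ℂ), ‖B s *ᵥ u‖ ≤ b s * ‖u‖) {u : ℝ → ι → ℂ} (hu : Continuous u) {N ζ : ℝ}
    (huN : ∀ s, ζ ≤ s → ‖u s‖ ≤ N) (k : ι) :
    IntegrableOn (fun s => (B s *ᵥ u s) k) (Ioi ζ) := by
  refine Integrable.mono' (hb.mul_const N).integrableOn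
    (continuous_mulVec_apply hB hu k).aestronglyMeasurable ?_
  filter_upwards [ae_restrict_mem measurableSet_Ioi] with s hs
  exact (norm_mulVec_apply_le hBb s _ k).trans
    (mul_le_mul_of_nonneg_left (huN s (le_of_lt hs)) (hb0 s))

theorem norm_tailDuhamel_mulVec_le (hν : ∀ k, 0 ≤ (ν k).re) (hb : Integrable b)
    (hb0 : ∀ s, 0 ≤ b s)
    (hBb : ∀ s (u : ι → ℂ), ‖B s *ᵥ u‖ ≤ b s * ‖u‖) {u : ℝ → ι → ℂ} {N ζ : ℝ}
    (huN : ∀ s, ζ ≤ s → ‖u s‖ ≤ N) (k : ι) :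
    ‖tailDuhamel (ν k) (fun s => (B s *ᵥ u s) k) ζ‖ ≤ (∫ s in Ioi ζ, b s) * N := by
  rw [← integral_mul_const]
  exact norm_tailDuhamel_le (hν k) (hb.mul_const N).integrableOn fun s hs =>
    (norm_mulVec_apply_le hBb s _ k).trans (mul_le_mul_of_nonneg_left (huN s hs.le) (hb0 s))

/-- The fixed point equation `u = a - ∫_ζ^∞ exp (ν (ζ - s)) B(s) u(s) ds` is solved on the whole line
by contraction in the sup norm. -/
theorem exists_solution_tendsto (hν : ∀ k, 0 ≤ (ν k).re) (hB : Continuous B) (hb : Integrable b)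
    (hb0 : ∀ s, 0 ≤ b s) (hBb : ∀ s (u : ι → ℂ), ‖B s *ᵥ u‖ ≤ b s * ‖u‖) (hδ : ∫ s, b s < 1)
    (ha : ∀ k, ν k * a k = 0) :
    ∃ u : ℝ → ι → ℂ, (∀ ζ, HasDerivAt u (fun k => ν k * u ζ k + (B ζ *ᵥ u ζ) k) ζ) ∧
      Tendsto u atTop (𝓝 a) := by
  have hle : ∀ ζ, ∫ s in Ioi ζ, b s ≤ ∫ s, b s := fun ζ =>
    setIntegral_le_integral hb (Eventually.of_forall hb0)
  have hδ0 : 0 ≤ ∫ s, b s := integral_nonneg hb0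
  set J : (ℝ → ι → ℂ) → ℝ → ι → ℂ := fun u ζ k =>
    a k - tailDuhamel (ν k) (fun s => (B s *ᵥ u s) k) ζ with hJ
  have hJder : ∀ u : BoundedContinuousFunction ℝ (ι → ℂ), ∀ ζ, HasDerivAt (J u)
      (fun k => ν k * J u ζ k + (B ζ *ᵥ u ζ) k) ζ := by
    intro u ζ
    refine hasDerivAt_pi.2 fun k => ?_
    have h1 := (hasDerivAt_tailDuhamel (hν k) (continuous_mulVec_apply hB u.continuous k)
      (integrableOn_mulVec_apply hB hb hb0 hBb u.continuous (ζ := 0)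
        (fun s _ => u.norm_coe_le_norm s) k) ζ).const_sub (a k)
    refine h1.congr_deriv ?_
    simp only [hJ]
    linear_combination -ha k
  have hJa : ∀ (u : BoundedContinuousFunction ℝ (ι → ℂ)) ζ,
      ‖J u ζ - a‖ ≤ (∫ s in Ioi ζ, b s) * ‖u‖ := by
    intro u ζ
    refine (pi_norm_le_iff_of_nonneg
      (mul_nonneg (integral_nonneg hb0) (norm_nonneg u))).2 fun k => ?_
    simp only [hJ, Pi.sub_apply, sub_sub_cancel_left, norm_neg]
    exact norm_tailDuhamel_mulVec_le hν hb hb0 hBb (fun s _ => u.norm_coe_le_norm s) k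
  have hJc : ∀ u : BoundedContinuousFunction ℝ (ι → ℂ), Continuous (J u) := fun u =>
    continuous_iff_continuousAt.2 fun ζ => (hJder u ζ).continuousAt
  let Φ : BoundedContinuousFunction ℝ (ι → ℂ) → BoundedContinuousFunction ℝ (ι → ℂ) := fun u =>
    BoundedContinuousFunction.ofNormedAddCommGroup (J u) (hJc u) (‖a‖ + (∫ s, b s) * ‖u‖)
      (fun ζ => by
        have h1 := hJa u ζ
        have h2 := mul_le_mul_of_nonneg_right (hle ζ) (norm_nonneg u)
        have h3 := norm_le_norm_add_norm_sub' (J u ζ) a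
        linarith)
  have hΦ : ContractingWith (∫ s, b s).toNNReal Φ := by
    refine ⟨by simpa using hδ, LipschitzWith.of_dist_le_mul fun u v => ?_⟩
    rw [Real.coe_toNNReal _ hδ0]
    refine (BoundedContinuousFunction.dist_le (by positivity)).2 fun ζ => ?_
    rw [dist_eq_norm]
    refine (pi_norm_le_iff_of_nonneg (by positivity)).2 fun k => ?_
    have e : (Φ u ζ - Φ v ζ) k = -tailDuhamel (ν k) (fun s => (B s *ᵥ (u - v) s) k) ζ := by
      change J u ζ k - J v ζ k = _
      simp only [hJ, sub_sub_sub_cancel_left, BoundedContinuousFunction.coe_sub, Pi.sub_apply,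
        mulVec_sub]
      rw [tailDuhamel_sub (hν k)
        (integrableOn_mulVec_apply hB hb hb0 hBb v.continuous
          (fun s _ => v.norm_coe_le_norm s) k)
        (integrableOn_mulVec_apply hB hb hb0 hBb u.continuous
          (fun s _ => u.norm_coe_le_norm s) k)]
      simp only [tailDuhamel, ← integral_neg, ← mul_neg, neg_sub]
    rw [e, norm_neg, dist_eq_norm]
    exact (norm_tailDuhamel_mulVec_le hν hb hb0 hBb
      (fun s _ => (u - v).norm_coe_le_norm s) k).trans
      (mul_le_mul_of_nonneg_right (hle ζ) (norm_nonneg _))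
  obtain ⟨u, hu⟩ : ∃ u, Φ u = u := ⟨_, hΦ.fixedPoint_isFixedPt⟩
  have hu' : J u = u := congrArg DFunLike.coe hu
  refine ⟨u, fun ζ => ?_, ?_⟩
  · have := hJder u ζ
    rwa [hu'] at this
  · rw [tendsto_iff_norm_sub_tendsto_zero]
    refine squeeze_zero (fun _ => norm_nonneg _) (fun ζ => hu' ▸ hJa u ζ) ?_
    simpa using (tendsto_integral_Ioi_zero (f := b) (μ := volume) tendsto_id).mul_const ‖u‖

/-- Solutions of `u' = diag ν u + B u` with limit `a` at `+∞` satisfy the fixed point equation on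
`[0, ∞)`, so `N = sup ‖u‖` obeys `N ≤ ‖a‖ + δ N` with `δ = ∫ b`. -/
theorem norm_solution_zero_sub_le (hν : ∀ k, 0 ≤ (ν k).re) (hB : Continuous B) (hb : Integrable b)
    (hb0 : ∀ s, 0 ≤ b s) (hBb : ∀ s (u : ι → ℂ), ‖B s *ᵥ u‖ ≤ b s * ‖u‖) (hδ : ∫ s, b s ≤ 1 / 2)
    (ha : ∀ k, ν k * a k = 0) {u : ℝ → ι → ℂ}
    (hu : ∀ ζ, HasDerivAt u (fun k => ν k * u ζ k + (B ζ *ᵥ u ζ) k) ζ)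
    (hua : Tendsto u atTop (𝓝 a)) :
    ‖u 0 - a‖ ≤ 2 * (∫ s, b s) * ‖a‖ := by
  have hle : ∀ ζ, ∫ s in Ioi ζ, b s ≤ ∫ s, b s := fun ζ =>
    setIntegral_le_integral hb (Eventually.of_forall hb0)
  have hδ0 : 0 ≤ ∫ s, b s := integral_nonneg hb0
  have huc : Continuous u := continuous_iff_continuousAt.2 fun ζ => (hu ζ).continuousAt
  obtain ⟨C, hC⟩ : ∃ C, ∀ ζ, 0 ≤ ζ → ‖u ζ‖ ≤ C := by
    obtain ⟨R, hR⟩ := eventually_atTop.1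
      (hua.norm.eventually (ge_mem_nhds (lt_add_one ‖a‖)))
    obtain ⟨C', hC'⟩ := (isCompact_Icc (a := (0 : ℝ)) (b := R)).exists_bound_of_continuousOn
      huc.continuousOn
    refine ⟨max C' (‖a‖ + 1), fun ζ hζ => ?_⟩
    rcases le_total ζ R with h | h
    · exact (hC' ζ ⟨hζ, h⟩).trans (le_max_left _ _)
    · exact (hR ζ h).trans (le_max_right _ _)
  have hi := fun k => integrableOn_mulVec_apply hB hb hb0 hBb huc hC k
  have hfix : ∀ ζ k, u ζ k = a k - tailDuhamel (ν k) (fun s => (B s *ᵥ u s) k) ζ := by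
    intro ζ₀ k
    -- The defect of the fixed point equation solves the unperturbed equation and tends to `0`.
    set d : ℝ → ℂ := fun ζ => u ζ k - a k + tailDuhamel (ν k) (fun s => (B s *ᵥ u s) k) ζ with hd
    have hdder : ∀ ζ, HasDerivAt d (ν k * d ζ) ζ := by
      intro ζ
      have h1 := ((hasDerivAt_pi.1 (hu ζ) k).sub_const (a k)).add
        (hasDerivAt_tailDuhamel (hν k) (continuous_mulVec_apply hB huc k) (hi k) ζ)
      refine h1.congr_deriv ?_
      simp only [hd]
      linear_combination ha k
    have hd0 : Tendsto d atTop (𝓝 0) := by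
      have h1 : Tendsto (fun ζ => u ζ k - a k) atTop (𝓝 0) := by
        simpa using (((continuous_apply k).tendsto a).comp hua).sub_const (a k)
      have h2 : Tendsto (tailDuhamel (ν k) (fun s => (B s *ᵥ u s) k)) atTop (𝓝 0) := by
        refine squeeze_zero_norm' (a := fun ζ => (∫ s in Ioi ζ, b s) * C) ?_ ?_
        · filter_upwards [eventually_ge_atTop 0] with ζ hζ
          exact norm_tailDuhamel_mulVec_le hν hb hb0 hBb (fun s hs => hC s (hζ.trans hs)) k
        · simpa using (tendsto_integral_Ioi_zero (f := b) (μ := volume) tendsto_id).mul_const C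
      simpa using h1.add h2
    -- `exp (-ν ζ) d ζ` is constant and tends to `0`, as `Re ν ≥ 0`.
    set w : ℝ → ℂ := fun ζ => Complex.exp (ν k * ((-ζ : ℝ) : ℂ)) * d ζ with hw
    have hwder : ∀ ζ, HasDerivAt w 0 ζ := by
      intro ζ
      have h1 : HasDerivAt (fun x : ℝ => Complex.exp (ν k * ((-x : ℝ) : ℂ)))
          (Complex.exp (ν k * ((-ζ : ℝ) : ℂ)) * -ν k) ζ := by
        have := (((Complex.ofRealCLM.hasDerivAt (x := ζ)).neg).const_mul (ν k)).cexp
        simpa using this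
      refine (h1.mul (hdder ζ)).congr_deriv ?_
      ring
    have hw0 : Tendsto w atTop (𝓝 0) := by
      refine squeeze_zero_norm' ?_ (by simpa using hd0.norm)
      filter_upwards [eventually_ge_atTop 0] with ζ hζ
      rw [hw, norm_mul]
      exact mul_le_of_le_one_left (norm_nonneg _)
        (norm_cexp_mul_ofReal_le_one (hν k) (neg_nonpos.2 hζ))
    have hconst : ∀ ζ, w ζ = w ζ₀ := fun ζ =>
      is_const_of_deriv_eq_zero (fun x => (hwder x).differentiableAt) (fun x => (hwder x).deriv) _ _
    have hz : w ζ₀ = 0 :=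
      tendsto_nhds_unique (tendsto_const_nhds.congr fun ζ => (hconst ζ).symm) hw0
    have : d ζ₀ = 0 := (mul_eq_zero.1 hz).resolve_left (Complex.exp_ne_zero _)
    rw [hd] at this
    linear_combination this
  have hstep : ∀ N, (∀ ζ, 0 ≤ ζ → ‖u ζ‖ ≤ N) → ∀ ζ, 0 ≤ ζ → ‖u ζ - a‖ ≤ (∫ s, b s) * N := by
    intro N hN ζ hζ
    have hN0 : 0 ≤ N := (norm_nonneg _).trans (hN 0 le_rfl)
    refine (pi_norm_le_iff_of_nonneg (mul_nonneg hδ0 hN0)).2 fun k => ?_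
    rw [Pi.sub_apply, hfix ζ k, sub_sub_cancel_left, norm_neg]
    exact (norm_tailDuhamel_mulVec_le hν hb hb0 hBb (fun s hs => hN s (hζ.trans hs)) k).trans
      (mul_le_mul_of_nonneg_right (hle ζ) hN0)
  have : Nonempty (Ici (0 : ℝ)) := ⟨⟨0, self_mem_Ici⟩⟩
  set N := ⨆ ζ : Ici (0 : ℝ), ‖u ζ‖ with hNdef
  have hN : ∀ ζ, 0 ≤ ζ → ‖u ζ‖ ≤ N := fun ζ hζ =>
    le_ciSup (f := fun ζ : Ici (0 : ℝ) => ‖u ζ‖) ⟨C, by rintro _ ⟨x, rfl⟩; exact hC x x.2⟩ ⟨ζ, hζ⟩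
  have hN0 : 0 ≤ N := (norm_nonneg _).trans (hN 0 le_rfl)
  have hN2 : N ≤ ‖a‖ + (∫ s, b s) * N := ciSup_le fun ζ => by
    have h1 := hstep N hN ζ ζ.2
    have h2 := norm_le_norm_add_norm_sub' (u ζ) a
    linarith
  have hN3 : N ≤ 2 * ‖a‖ := by nlinarith
  calc _ ≤ (∫ s, b s) * N := hstep N hN 0 le_rfl
    _ ≤ (∫ s, b s) * (2 * ‖a‖) := by gcongr
    _ = _ := by ring

end System

/-! ### Perturbations of a diagonalizable matrix -/

section Conjugation

variable {ι : Type*} [Fintype ι]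

theorem hasDerivAt_mulVec (M : Matrix ι ι ℂ) {u : ℝ → ι → ℂ} {u' : ι → ℂ} {ζ : ℝ}
    (hu : HasDerivAt u u' ζ) : HasDerivAt (fun x => M *ᵥ u x) (M *ᵥ u') ζ := by
  refine hasDerivAt_pi.2 fun i => ?_
  simp only [mulVec, dotProduct]
  exact HasDerivAt.fun_sum fun j _ => (hasDerivAt_pi.1 hu j).const_mul _

theorem norm_mulVec_le_of_entry_le {M : Matrix ι ι ℂ} {b : ℝ} (hb : 0 ≤ b)
    (hM : ∀ i j, ‖M i j‖ ≤ b) (u : ι → ℂ) : ‖M *ᵥ u‖ ≤ Fintype.card ι * b * ‖u‖ := by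
  refine (pi_norm_le_iff_of_nonneg (by positivity)).2 fun i => ?_
  calc ‖∑ j, M i j * u j‖ ≤ ∑ _j : ι, b * ‖u‖ := by
        refine norm_sum_le_of_le _ fun j _ => ?_
        rw [norm_mul]
        exact mul_le_mul (hM i j) (norm_le_pi_norm u j) (norm_nonneg _) hb
    _ = _ := by simp [mul_assoc]

variable [DecidableEq ι] {A S T : Matrix ι ι ℂ} {ν : ι → ℂ} {μ : ℂ} {P : ℝ → Matrix ι ι ℂ}
  {b : ℝ → ℝ} {r : ι → ℂ}

theorem coord_mul_eq_diagonal_mul_coord (hTS : T * S = 1) (hAS : A * S = S * diagonal ν) :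
    T * A = diagonal ν * T := by
  calc T * A = T * (A * S) * T := by
        rw [Matrix.mul_assoc, Matrix.mul_assoc, mul_eq_one_comm.1 hTS, Matrix.mul_one]
    _ = diagonal ν * T := by rw [hAS, ← Matrix.mul_assoc, hTS, Matrix.one_mul]

/-- An eigenvector for `μ` has vanishing coordinates, in an eigenbasis, along the eigenvectors
for other eigenvalues. -/
theorem sub_mul_coord_eq_zero (hTS : T * S = 1) (hAS : A * S = S * diagonal ν)
    (hr : A *ᵥ r = μ • r) (k : ι) : (ν k - μ) * (T *ᵥ r) k = 0 := by
  have hTA := coord_mul_eq_diagonal_mul_coord hTS hAS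
  have h : (T * A) *ᵥ r = μ • T *ᵥ r := by rw [← mulVec_mulVec, hr, mulVec_smul]
  rw [hTA, ← mulVec_mulVec] at h
  have := congrFun h k
  rw [mulVec_diagonal, Pi.smul_apply, smul_eq_mul] at this
  linear_combination this

/-- Existence of the solution of `y' = (A + P) y` that behaves like `exp (μ ζ) r` at `+∞`, for a
diagonalizable `A`, an eigenvalue `μ` of least real part and a small integrable perturbation. -/
theorem exists_solution_tendsto_eigenvector (hTS : T * S = 1) (hAS : A * S = S * diagonal ν)
    (hν : ∀ k, μ.re ≤ (ν k).re) (hP : Continuous P) (hb : Integrable b) (hb0 : ∀ s, 0 ≤ b s)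
    (hPb : ∀ s i j, ‖(T * P s * S) i j‖ ≤ b s) (hδ : Fintype.card ι * ∫ s, b s ≤ 1 / 2)
    (hr : A *ᵥ r = μ • r) :
    ∃ y : ℝ → ι → ℂ, (∀ ζ, HasDerivAt y ((A + P ζ) *ᵥ y ζ) ζ) ∧
      Tendsto (fun ζ : ℝ => Complex.exp (-(μ * ζ)) • y ζ) atTop (𝓝 r) := by
  have hST : S * T = 1 := mul_eq_one_comm.1 hTS
  obtain ⟨u, hu, hur⟩ := exists_solution_tendsto (ν := fun k => ν k - μ)
    (B := fun s => T * P s * S) (b := fun s => Fintype.card ι * b s) (a := T *ᵥ r)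
    (fun k => by simpa using hν k) (by fun_prop) (hb.const_mul _)
    (fun s => mul_nonneg (Nat.cast_nonneg _) (hb0 s))
    (fun s v => norm_mulVec_le_of_entry_le (hb0 s) (hPb s) v)
    (by rw [integral_const_mul]; linarith) (sub_mul_coord_eq_zero hTS hAS hr)
  refine ⟨fun ζ => Complex.exp (μ * (ζ : ℂ)) • S *ᵥ u ζ, fun ζ => ?_, ?_⟩
  · refine ((hasDerivAt_cexp_mul_ofReal μ ζ).smul (hasDerivAt_mulVec S (hu ζ))).congr_deriv ?_
    have e : (fun k => (ν k - μ) * u ζ k + ((T * P ζ * S) *ᵥ u ζ) k) =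
        diagonal ν *ᵥ u ζ - μ • u ζ + (T * P ζ * S) *ᵥ u ζ := by
      funext k
      simp only [Pi.add_apply, Pi.sub_apply, mulVec_diagonal, Pi.smul_apply, smul_eq_mul]
      ring
    rw [e, mulVec_add, mulVec_sub, mulVec_mulVec, ← hAS, mulVec_smul, mulVec_mulVec,
      ← Matrix.mul_assoc, ← Matrix.mul_assoc, hST, Matrix.one_mul, mulVec_smul, add_mulVec,
      mulVec_mulVec, mulVec_mulVec]
    module
  · have h1 : Tendsto (fun ζ => S *ᵥ u ζ) atTop (𝓝 (S *ᵥ T *ᵥ r)) :=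
      ((Continuous.matrix_mulVec continuous_const continuous_id).tendsto _).comp hur
    rw [mulVec_mulVec, hST, one_mulVec] at h1
    refine h1.congr fun ζ => ?_
    rw [smul_smul, ← Complex.exp_add, neg_add_cancel, Complex.exp_zero, one_smul]

/-- Every solution of `y' = (A + P) y` that behaves like `exp (μ ζ) r` at `+∞` starts near `r`,
measured in the coordinates `T` of the eigenbasis. -/
theorem norm_coord_zero_sub_le (hTS : T * S = 1) (hAS : A * S = S * diagonal ν)
    (hν : ∀ k, μ.re ≤ (ν k).re) (hP : Continuous P) (hb : Integrable b) (hb0 : ∀ s, 0 ≤ b s)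
    (hPb : ∀ s i j, ‖(T * P s * S) i j‖ ≤ b s) (hδ : Fintype.card ι * ∫ s, b s ≤ 1 / 2)
    (hr : A *ᵥ r = μ • r) {y : ℝ → ι → ℂ} (hy : ∀ ζ, HasDerivAt y ((A + P ζ) *ᵥ y ζ) ζ)
    (hyr : Tendsto (fun ζ : ℝ => Complex.exp (-(μ * ζ)) • y ζ) atTop (𝓝 r)) :
    ‖T *ᵥ y 0 - T *ᵥ r‖ ≤ 2 * (Fintype.card ι * ∫ s, b s) * ‖T *ᵥ r‖ := by
  have hST : S * T = 1 := mul_eq_one_comm.1 hTS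
  have hTA := coord_mul_eq_diagonal_mul_coord hTS hAS
  have key := norm_solution_zero_sub_le (ν := fun k => ν k - μ)
    (B := fun s => T * P s * S) (b := fun s => Fintype.card ι * b s) (a := T *ᵥ r)
    (u := fun ζ => Complex.exp (-μ * (ζ : ℂ)) • T *ᵥ y ζ)
    (fun k => by simpa using hν k) (by fun_prop) (hb.const_mul _)
    (fun s => mul_nonneg (Nat.cast_nonneg _) (hb0 s))
    (fun s v => norm_mulVec_le_of_entry_le (hb0 s) (hPb s) v)
    (by rwa [integral_const_mul]) (sub_mul_coord_eq_zero hTS hAS hr) ?_ ?_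
  · simpa [integral_const_mul] using key
  · intro ζ
    refine ((hasDerivAt_cexp_mul_ofReal (-μ) ζ).smul (hasDerivAt_mulVec T (hy ζ))).congr_deriv ?_
    set w := T *ᵥ y ζ with hw
    set E := Complex.exp (-μ * (ζ : ℂ))
    have hSw : S *ᵥ w = y ζ := by rw [hw, mulVec_mulVec, hST, one_mulVec]
    have e : (fun k => (ν k - μ) * (E • w) k + ((T * P ζ * S) *ᵥ (E • w)) k) =
        diagonal ν *ᵥ (E • w) - μ • (E • w) + (T * P ζ * S) *ᵥ (E • w) := by
      funext k
      simp only [Pi.add_apply, Pi.sub_apply, mulVec_diagonal, Pi.smul_apply, smul_eq_mul]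
      ring
    rw [e, add_mulVec, mulVec_add, mulVec_mulVec, hTA, ← mulVec_mulVec, ← hw, mulVec_smul,
      mulVec_smul, ← mulVec_mulVec (M := T * P ζ), hSw, mulVec_mulVec (M := T)]
    module
  · have h1 : Tendsto (fun ζ : ℝ => T *ᵥ (Complex.exp (-(μ * ζ)) • y ζ)) atTop (𝓝 (T *ᵥ r)) :=
      ((Continuous.matrix_mulVec continuous_const continuous_id).tendsto _).comp hyr
    refine h1.congr fun ζ => ?_
    rw [mulVec_smul, neg_mul]

end Conjugation

/-! ### The eigenvalues of the limit matrix -/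

open Polynomial in
theorem eval_charpoly_MInf (c : ℝ) (lam x : ℂ) : (MInf c lam).charpoly.eval x =
    x ^ 4 - (1 - (c : ℂ) ^ 2) * x ^ 2 - 2 * lam * c * x + lam ^ 2 := by
  rw [Matrix.eval_charpoly]
  simp [MInf, Matrix.det_succ_row_zero, Fin.sum_univ_succ, Fin.succAbove]
  ring

open Polynomial in
theorem charpoly_MInf (c : ℝ) (lam : ℂ) : (MInf c lam).charpoly =
    X ^ 4 - C (1 - (c : ℂ) ^ 2) * X ^ 2 - C (2 * lam * c) * X + C (lam ^ 2) := by
  refine Polynomial.funext fun x => ?_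
  rw [eval_charpoly_MInf]
  simp

/-- The derivative of the characteristic polynomial of `𝓜_∞(λ)`. -/
def charDeriv (c : ℝ) (lam x : ℂ) : ℂ :=
  4 * x ^ 3 - 2 * (1 - (c : ℂ) ^ 2) * x - 2 * lam * c

/-- `ρ` lists the eigenvalues of `𝓜_∞(λ)`, which are assumed to be simple. -/
structure IsRootList (c : ℝ) (lam : ℂ) (ρ : Fin 4 → ℂ) : Prop where
  roots_eq : (MInf c lam).charpoly.roots = Finset.univ.val.map ρ
  charDeriv_ne : ∀ i, charDeriv c lam (ρ i) ≠ 0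
  injective : Function.Injective ρ

theorem exists_isRootList {c : ℝ} {lam : ℂ}
    (h : ∀ x, x ^ 4 - (1 - (c : ℂ) ^ 2) * x ^ 2 - 2 * lam * c * x + lam ^ 2 = 0 →
      charDeriv c lam x ≠ 0) : ∃ ρ, IsRootList c lam ρ := by
  set f := (MInf c lam).charpoly with hf
  have hf0 : f ≠ 0 := (Matrix.charpoly_monic _).ne_zero
  have hder : ∀ x, f.derivative.eval x = charDeriv c lam x := by
    intro x
    rw [hf, charpoly_MInf, charDeriv]
    generalize lam ^ 2 = q
    generalize 2 * lam * (c : ℂ) = q'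
    generalize 1 - (c : ℂ) ^ 2 = q''
    simp
    ring
  have hnd : f.roots.Nodup := by
    refine Multiset.nodup_iff_count_le_one.2 fun x => ?_
    rw [Polynomial.count_roots]
    -- A repeated root would be a zero of the derivative.
    by_contra hlt
    obtain ⟨h1, h2⟩ := (Polynomial.one_lt_rootMultiplicity_iff_isRoot hf0).1 (not_le.1 hlt)
    rw [Polynomial.IsRoot, hder] at h2
    rw [Polynomial.IsRoot, hf, eval_charpoly_MInf] at h1
    exact h x h1 h2
  have hcard : f.roots.card = 4 := by
    rw [IsAlgClosed.card_roots_eq_natDegree, hf, Matrix.charpoly_natDegree_eq_dim,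
      Fintype.card_fin]
  obtain ⟨L, hL⟩ := Quot.exists_rep f.roots
  have hL' : (L : Multiset ℂ) = f.roots := hL
  have hlen : L.length = 4 := by rw [← hcard, ← hL', Multiset.coe_card]
  have hmap : f.roots = Finset.univ.val.map (fun i : Fin 4 => L.get (i.cast hlen.symm)) := by
    rw [← hL']
    obtain ⟨a, b, c, d, rfl⟩ := List.length_eq_four.1 hlen
    rfl
  refine ⟨_, hmap, fun i => h _ ?_, ?_⟩
  · have hm : L.get (i.cast hlen.symm) ∈ f.roots := by
      rw [hmap]
      exact Multiset.mem_map_of_mem _ (Finset.mem_univ_val i)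
    have := (Polynomial.mem_roots hf0).1 hm
    rwa [Polynomial.IsRoot, hf, eval_charpoly_MInf] at this
  · intro i j hij
    rw [hmap] at hnd
    exact Multiset.inj_on_of_nodup_map hnd i (Finset.mem_univ_val i) j (Finset.mem_univ_val j) hij

namespace IsRootList

variable {c : ℝ} {lam : ℂ} {ρ : Fin 4 → ℂ}

theorem isRoot (h : IsRootList c lam ρ) (i : Fin 4) :
    ρ i ^ 4 - (1 - (c : ℂ) ^ 2) * ρ i ^ 2 - 2 * lam * c * ρ i + lam ^ 2 = 0 := by
  have hm : ρ i ∈ (MInf c lam).charpoly.roots := by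
    rw [h.roots_eq]
    exact Multiset.mem_map_of_mem _ (Finset.mem_univ_val i)
  rw [← eval_charpoly_MInf]
  exact (Polynomial.mem_roots (Matrix.charpoly_monic _).ne_zero).1 hm

theorem sum_eq_zero (h : IsRootList c lam ρ) : ∑ i, ρ i = 0 := by
  have h1 := Matrix.trace_eq_sum_roots_charpoly (MInf c lam)
  rw [h.roots_eq] at h1
  rw [Finset.sum, ← h1]
  simp [MInf, Matrix.trace, Fin.sum_univ_four]

theorem muWedge_eq (h : IsRootList c lam ρ) :
    muWedge c lam = ∑ i, if (ρ i).re < 0 then ρ i else 0 := by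
  rw [muWedge, h.roots_eq, Multiset.filter_map, ← Finset.sum_filter]
  rfl

/-- The eigenvalues in the left half-plane have the least real part among all sums of distinct
eigenvalues. -/
theorem re_muWedge_le (h : IsRootList c lam ρ) {i j : Fin 4} (hij : i ≠ j) :
    (muWedge c lam).re ≤ (ρ i + ρ j).re := by
  have h1 : (muWedge c lam).re = ∑ i, min (ρ i).re 0 := by
    rw [h.muWedge_eq, Complex.re_sum]
    refine Finset.sum_congr rfl fun i _ => ?_
    split_ifs with hi
    · rw [min_eq_left hi.le]
    · rw [min_eq_right (not_lt.1 hi), Complex.zero_re]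
  have h2 : ∑ k, min (ρ k).re 0 ≤ ∑ k ∈ {i, j}, min (ρ k).re 0 := by
    rw [← Finset.sum_sdiff (Finset.subset_univ {i, j})]
    exact add_le_of_nonpos_left (Finset.sum_nonpos fun k _ => min_le_right _ _)
  rw [Finset.sum_pair hij] at h2
  rw [h1, Complex.add_re]
  exact h2.trans (add_le_add (min_le_left _ _) (min_le_left _ _))

end IsRootList

/-- On the imaginary axis the characteristic equation reads `(λ - c μ)² = -(τ⁴ + τ²)`, which forces
`λ` to be imaginary. -/
theorem re_ne_zero_of_isRoot {c : ℝ} {lam x : ℂ} (hlam : 0 < lam.re)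
    (hx : x ^ 4 - (1 - (c : ℂ) ^ 2) * x ^ 2 - 2 * lam * c * x + lam ^ 2 = 0) : x.re ≠ 0 := by
  intro h0
  have hx' : x = (x.im : ℂ) * Complex.I := by
    apply Complex.ext <;> simp [h0]
  set t := x.im
  have h1 : (lam - c * x) ^ 2 = ((-(t ^ 4 + t ^ 2) : ℝ) : ℂ) := by
    have h2 : (lam - c * x) ^ 2 = x ^ 2 - x ^ 4 := by linear_combination hx
    rw [h2, hx']
    push_cast
    linear_combination ((t : ℂ) ^ 2 - (t : ℂ) ^ 4 * (Complex.I ^ 2 - 1)) * Complex.I_sq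
  have h3 : (lam - c * x).re = lam.re := by simp [h0]
  have hre := congrArg Complex.re h1
  have him := congrArg Complex.im h1
  rw [pow_two, Complex.mul_re, h3, Complex.ofReal_re] at hre
  rw [pow_two, Complex.mul_im, h3, Complex.ofReal_im] at him
  have h4 : (lam - c * x).im = 0 := by
    have : lam.re * (lam - c * x).im = 0 := by linarith
    exact (mul_eq_zero.1 this).resolve_left hlam.ne'
  rw [h4] at hre
  nlinarith [mul_pos hlam hlam, sq_nonneg t, sq_nonneg (t ^ 2)]

/-! ### The eigenbasis of the second exterior power -/

/-- The right eigenvector of the companion matrix `𝓜_∞(λ)` for the eigenvalue `x`. -/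
def rightVec (x : ℂ) : Fin 4 → ℂ := ![1, x, x ^ 2, x ^ 3]

/-- The left eigenvector of `𝓜_∞(λ)` for the eigenvalue `x`: the coefficients in `y` of
`(f y - f x) / (y - x)`, with `f` the characteristic polynomial. -/
def leftVec (c : ℝ) (lam x : ℂ) : Fin 4 → ℂ :=
  ![x ^ 3 - (1 - (c : ℂ) ^ 2) * x - 2 * lam * c, x ^ 2 - (1 - (c : ℂ) ^ 2), x, 1]

/-- The coordinates of `a ∧ b` in the basis `1∧2, 1∧3, 1∧4, 2∧3, 2∧4, 3∧4`. -/
def wedge (a b : Fin 4 → ℂ) : Fin 6 → ℂ :=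
  ![a 0 * b 1 - a 1 * b 0, a 0 * b 2 - a 2 * b 0, a 0 * b 3 - a 3 * b 0,
    a 1 * b 2 - a 2 * b 1, a 1 * b 3 - a 3 * b 1, a 2 * b 3 - a 3 * b 2]

theorem wedge_dotProduct_wedge (a b d e : Fin 4 → ℂ) :
    wedge a b ⬝ᵥ wedge d e = (a ⬝ᵥ d) * (b ⬝ᵥ e) - (a ⬝ᵥ e) * (b ⬝ᵥ d) := by
  simp only [wedge, dotProduct, Fin.sum_univ_six, Fin.sum_univ_four, cons_val]
  ring

theorem MWedgeInf_mulVec_wedge {c : ℝ} {lam x y : ℂ}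
    (hx : x ^ 4 - (1 - (c : ℂ) ^ 2) * x ^ 2 - 2 * lam * c * x + lam ^ 2 = 0)
    (hy : y ^ 4 - (1 - (c : ℂ) ^ 2) * y ^ 2 - 2 * lam * c * y + lam ^ 2 = 0) :
    MWedgeInf c lam *ᵥ wedge (rightVec x) (rightVec y) =
      (x + y) • wedge (rightVec x) (rightVec y) := by
  funext k
  fin_cases k <;>
    simp [MWedgeInf, wedgeMatrix, wedge, rightVec, mulVec, dotProduct, Fin.sum_univ_six]
  · ring
  · ring
  · linear_combination hx - hy
  · ring
  · linear_combination y * hx - x * hy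
  · linear_combination y ^ 2 * hx - x ^ 2 * hy

/-- First index of the `k`-th pair `i < j` of elements of `Fin 4`. -/
def pairFst : Fin 6 → Fin 4 := ![0, 0, 0, 1, 1, 2]

/-- Second index of the `k`-th pair `i < j` of elements of `Fin 4`. -/
def pairSnd : Fin 6 → Fin 4 := ![1, 2, 3, 2, 3, 3]

theorem pairFst_ne_pairSnd (k : Fin 6) : pairFst k ≠ pairSnd k := by
  revert k; decide

/-- The matrix whose columns are the eigenvectors `vᵢ ∧ vⱼ` of `𝓜^∧_∞(λ)`. -/
def eigenBasis (ρ : Fin 4 → ℂ) : Matrix (Fin 6) (Fin 6) ℂ :=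
  of fun m k => wedge (rightVec (ρ (pairFst k))) (rightVec (ρ (pairSnd k))) m

/-- The inverse of `eigenBasis ρ`: its rows are the normalized left eigenvectors. -/
noncomputable def eigenCoord (c : ℝ) (lam : ℂ) (ρ : Fin 4 → ℂ) : Matrix (Fin 6) (Fin 6) ℂ :=
  of fun k m => (charDeriv c lam (ρ (pairFst k)) * charDeriv c lam (ρ (pairSnd k)))⁻¹ *
    wedge (leftVec c lam (ρ (pairFst k))) (leftVec c lam (ρ (pairSnd k))) m

/-- The eigenvalues `ρᵢ + ρⱼ` of `𝓜^∧_∞(λ)`. -/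
def pairSum (ρ : Fin 4 → ℂ) (k : Fin 6) : ℂ := ρ (pairFst k) + ρ (pairSnd k)

namespace IsRootList

variable {c : ℝ} {lam : ℂ} {ρ : Fin 4 → ℂ}

theorem leftVec_dotProduct_rightVec (h : IsRootList c lam ρ) (i j : Fin 4) :
    leftVec c lam (ρ i) ⬝ᵥ rightVec (ρ j) = if i = j then charDeriv c lam (ρ i) else 0 := by
  have e : leftVec c lam (ρ i) ⬝ᵥ rightVec (ρ j) =
      ρ i ^ 3 - (1 - (c : ℂ) ^ 2) * ρ i - 2 * lam * c + (ρ i ^ 2 - (1 - (c : ℂ) ^ 2)) * ρ j +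
        ρ i * ρ j ^ 2 + ρ j ^ 3 := by
    simp [leftVec, rightVec, dotProduct, Fin.sum_univ_four]
  split_ifs with hij
  · subst hij
    rw [e, charDeriv]
    ring
  · have h1 : (ρ j - ρ i) * (leftVec c lam (ρ i) ⬝ᵥ rightVec (ρ j)) = 0 := by
      rw [e]
      linear_combination h.isRoot j - h.isRoot i
    exact (mul_eq_zero.1 h1).resolve_left
      (sub_ne_zero.2 fun h' => hij (h.injective h').symm)

theorem eigenCoord_mul_eigenBasis (h : IsRootList c lam ρ) :
    eigenCoord c lam ρ * eigenBasis ρ = 1 := by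
  ext k m
  have e : (eigenCoord c lam ρ * eigenBasis ρ) k m =
      (charDeriv c lam (ρ (pairFst k)) * charDeriv c lam (ρ (pairSnd k)))⁻¹ *
        (wedge (leftVec c lam (ρ (pairFst k))) (leftVec c lam (ρ (pairSnd k))) ⬝ᵥ
          wedge (rightVec (ρ (pairFst m))) (rightVec (ρ (pairSnd m)))) := by
    simp only [eigenCoord, eigenBasis, mul_apply, of_apply, dotProduct, Finset.mul_sum, mul_assoc]
  rw [e, wedge_dotProduct_wedge]
  simp only [h.leftVec_dotProduct_rightVec]
  -- Both pairs are increasing, so one cannot be the other in reverse order.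
  have h1 : ∀ k m : Fin 6, ¬ (pairFst k = pairSnd m ∧ pairSnd k = pairFst m) := by decide
  have h2 : ∀ k m : Fin 6, pairFst k = pairFst m → pairSnd k = pairSnd m → k = m := by decide
  have z : (if pairFst k = pairSnd m then charDeriv c lam (ρ (pairFst k)) else 0) *
      (if pairSnd k = pairFst m then charDeriv c lam (ρ (pairSnd k)) else 0) = 0 := by
    by_cases ha : pairFst k = pairSnd m
    · rw [if_neg fun hb => h1 k m ⟨ha, hb⟩, mul_zero]
    · rw [if_neg ha, zero_mul]
  rw [z, sub_zero]
  by_cases hkm : k = m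
  · subst hkm
    simp
    field_simp [h.charDeriv_ne]
  · rw [one_apply_ne hkm]
    by_cases ha : pairFst k = pairFst m
    · rw [if_neg (c := pairSnd k = pairSnd m) fun hb => hkm (h2 k m ha hb), mul_zero, mul_zero]
    · rw [if_neg ha, zero_mul, mul_zero]

theorem MWedgeInf_mul_eigenBasis (h : IsRootList c lam ρ) :
    MWedgeInf c lam * eigenBasis ρ = eigenBasis ρ * diagonal (pairSum ρ) := by
  ext m k
  have := congrFun (MWedgeInf_mulVec_wedge (h.isRoot (pairFst k)) (h.isRoot (pairSnd k))) m
  rw [mul_diagonal]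
  simpa [eigenBasis, mul_apply, mulVec, dotProduct, pairSum, mul_comm] using this

/-- If `μ^∧` is a sum of two eigenvalues, it is so in only one way: overlapping pairs have distinct
sums, and the sums over complementary pairs are opposite, so that equality of these would give
`μ^∧ = 0` and, by minimality of its real part, put all eigenvalues on the imaginary axis. -/
theorem eq_of_pairSum_eq_muWedge (h : IsRootList c lam ρ) (hlam : 0 < lam.re) {k m : Fin 6}
    (hk : pairSum ρ k = muWedge c lam) (hm : pairSum ρ m = muWedge c lam) : k = m := by
  have hs : ρ 0 + ρ 1 + ρ 2 + ρ 3 = 0 := by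
    rw [← Fin.sum_univ_four]
    exact h.sum_eq_zero
  have hmu : muWedge c lam ≠ 0 := by
    intro h0
    have hle : ∀ i j : Fin 4, i ≠ j → 0 ≤ (ρ i).re + (ρ j).re := fun i j hij => by
      have := h.re_muWedge_le hij
      rwa [h0, Complex.zero_re, Complex.add_re] at this
    have hs' : (ρ 0).re + (ρ 1).re + (ρ 2).re + (ρ 3).re = 0 := by
      simpa using congrArg Complex.re hs
    refine re_ne_zero_of_isRoot hlam (h.isRoot 0) ?_
    linarith [hle 0 1 (by decide), hle 0 2 (by decide), hle 0 3 (by decide),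
      hle 1 2 (by decide), hle 1 3 (by decide), hle 2 3 (by decide)]
  -- The pairs are listed so that complementary pairs have indices adding up to `5`.
  have hcases : ∀ k m : Fin 6, k = m ∨
      (pairFst k = pairFst m ∧ pairSnd k ≠ pairSnd m) ∨
      (pairFst k = pairSnd m ∧ pairSnd k ≠ pairFst m) ∨
      (pairSnd k = pairFst m ∧ pairFst k ≠ pairSnd m) ∨
      (pairSnd k = pairSnd m ∧ pairFst k ≠ pairFst m) ∨ k + m = 5 := by decide
  have hkm := hk.trans hm.symm
  rw [pairSum, pairSum] at hkm
  rcases hcases k m with h1 | ⟨h1, h2⟩ | ⟨h1, h2⟩ | ⟨h1, h2⟩ | ⟨h1, h2⟩ | h1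
  · exact h1
  · exact absurd (h.injective (by rw [h1] at hkm; linear_combination hkm)) h2
  · exact absurd (h.injective (by rw [h1] at hkm; linear_combination hkm)) h2
  · exact absurd (h.injective (by rw [h1] at hkm; linear_combination hkm)) h2
  · exact absurd (h.injective (by rw [h1] at hkm; linear_combination hkm)) h2
  · refine absurd ?_ hmu
    have h3 : pairSum ρ k + pairSum ρ m = 0 := by
      obtain rfl : m = 5 - k := by rw [← h1]; abel
      fin_cases k <;> simp [pairSum, pairFst, pairSnd] <;> linear_combination hs
    rw [hk, hm] at h3
    linear_combination h3 / 2

end IsRootList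

/-! ### Growth estimates on the scale of the square root of the spectral parameter -/

theorem norm_one_sub_sq_le {c : ℝ} (hc0 : 0 ≤ c) (hc1 : c < 1) : ‖1 - (c : ℂ) ^ 2‖ ≤ 1 := by
  rw [← Complex.ofReal_pow, ← Complex.ofReal_one, ← Complex.ofReal_sub, Complex.norm_real,
    Real.norm_eq_abs, abs_le]
  constructor <;> nlinarith

section RootBounds

variable {c : ℝ} {lam x y : ℂ} {κ : ℝ}

theorem norm_two_mul_mul_le (hc0 : 0 ≤ c) (hc1 : c < 1) (hκ : ‖lam‖ = κ ^ 2) :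
    ‖2 * lam * (c : ℂ)‖ ≤ 2 * κ ^ 2 := by
  rw [norm_mul, norm_mul, hκ, Complex.norm_real, Real.norm_of_nonneg hc0, Complex.norm_two]
  nlinarith [sq_nonneg κ]

/-- The eigenvalues of `𝓜_∞(λ)` grow at most like `κ = |λ|^{1/2}`. -/
theorem norm_root_le (hc0 : 0 ≤ c) (hc1 : c < 1) (hκ1 : 10 ≤ κ) (hκ : ‖lam‖ = κ ^ 2)
    (hx : x ^ 4 - (1 - (c : ℂ) ^ 2) * x ^ 2 - 2 * lam * c * x + lam ^ 2 = 0) :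
    ‖x‖ ≤ 2 * κ := by
  have h1 : ‖x‖ ^ 4 ≤ ‖x‖ ^ 2 + 2 * κ ^ 2 * ‖x‖ + κ ^ 4 := by
    have e : x ^ 4 = (1 - (c : ℂ) ^ 2) * x ^ 2 + 2 * lam * c * x + -lam ^ 2 := by
      linear_combination hx
    rw [← norm_pow, e]
    refine (norm_add₃_le).trans ?_
    rw [norm_mul, norm_mul, norm_neg, norm_pow, norm_pow, hκ]
    have h2 := mul_le_mul_of_nonneg_right (norm_one_sub_sq_le hc0 hc1) (sq_nonneg ‖x‖)
    have h3 := mul_le_mul_of_nonneg_right (norm_two_mul_mul_le hc0 hc1 hκ) (norm_nonneg x)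
    nlinarith
  by_contra hlt
  push Not at hlt
  set t := ‖x‖
  have ht : 20 < t := by linarith
  have hk2 : κ ^ 2 ≤ t ^ 2 / 4 := by nlinarith
  have hk4 : κ ^ 4 ≤ t ^ 4 / 16 := by nlinarith [sq_nonneg κ, sq_nonneg t]
  have h5 : κ ^ 2 * t ≤ t ^ 2 / 4 * t := by gcongr
  have h6 : t ^ 3 * 20 ≤ t ^ 4 := by nlinarith [pow_pos (by linarith : 0 < t) 3]
  have h7 : t ^ 2 * 400 ≤ t ^ 4 := by nlinarith [pow_pos (by linarith : 0 < t) 2]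
  have h8 : 0 < t ^ 4 := by positivity
  nlinarith

/-- The eigenvalues of `𝓜_∞(λ)` are uniformly separated on the scale `κ`. The proof multiplies
the derivative by `x` to make the term `4 x⁴ ≈ -4 λ²` appear. -/
theorem le_norm_charDeriv (hc0 : 0 ≤ c) (hc1 : c < 1) (hκ1 : 10 ≤ κ) (hκ : ‖lam‖ = κ ^ 2)
    (hx : x ^ 4 - (1 - (c : ℂ) ^ 2) * x ^ 2 - 2 * lam * c * x + lam ^ 2 = 0) :
    κ ^ 3 ≤ ‖charDeriv c lam x‖ := by
  have hκ0 : 0 < κ := by linarith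
  have hxκ := norm_root_le hc0 hc1 hκ1 hκ hx
  have e : 4 * lam ^ 2 = 2 * ((1 - (c : ℂ) ^ 2) * x ^ 2) + 3 * (2 * lam * c * x) +
      -(charDeriv c lam x * x) := by
    rw [charDeriv]
    linear_combination 4 * hx
  have h1 : 4 * κ ^ 4 ≤ 2 * ‖x‖ ^ 2 + 3 * (2 * κ ^ 2 * ‖x‖) + ‖charDeriv c lam x‖ * ‖x‖ := by
    have h0 : ‖4 * lam ^ 2‖ = 4 * κ ^ 4 := by
      rw [norm_mul, norm_pow, hκ, Complex.norm_ofNat]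
      ring
    rw [← h0, e]
    refine (norm_add₃_le).trans ?_
    rw [norm_neg, norm_mul, norm_mul, norm_mul, norm_mul (2 * lam * (c : ℂ)),
      norm_mul (charDeriv _ _ _), norm_pow, Complex.norm_ofNat, Complex.norm_ofNat]
    have h2 := mul_le_mul_of_nonneg_right (norm_one_sub_sq_le hc0 hc1) (sq_nonneg ‖x‖)
    have h3 := mul_le_mul_of_nonneg_right (norm_two_mul_mul_le hc0 hc1 hκ) (norm_nonneg x)
    nlinarith
  have h2 : ‖x‖ ^ 2 ≤ (2 * κ) ^ 2 := by gcongr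
  have h3 : κ ^ 2 * ‖x‖ ≤ κ ^ 2 * (2 * κ) := by gcongr
  have h4 : ‖charDeriv c lam x‖ * ‖x‖ ≤ ‖charDeriv c lam x‖ * (2 * κ) := by gcongr
  have h5 : κ ^ 3 * 10 ≤ κ ^ 4 := by nlinarith [pow_pos hκ0 3]
  have h6 : κ ^ 2 * 100 ≤ κ ^ 4 := by nlinarith [pow_pos hκ0 2]
  by_contra hlt
  push Not at hlt
  have h7 : ‖charDeriv c lam x‖ * (2 * κ) ≤ κ ^ 3 * (2 * κ) := by gcongr
  have h8 : 0 < κ ^ 4 := by positivity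
  nlinarith

theorem norm_wedge_rightVec_le (hx : ‖x‖ ≤ 2 * κ) (hy : ‖y‖ ≤ 2 * κ) :
    ‖wedge (rightVec x) (rightVec y) 0‖ ≤ 4 * κ ∧
      ‖wedge (rightVec x) (rightVec y) 1‖ ≤ 8 * κ ^ 2 ∧
      ‖wedge (rightVec x) (rightVec y) 3‖ ≤ 16 * κ ^ 3 := by
  have hκ0 : 0 ≤ κ := by linarith [norm_nonneg x]
  simp only [wedge, rightVec, cons_val, one_mul, mul_one]
  refine ⟨(norm_sub_le _ _).trans (by linarith), (norm_sub_le _ _).trans ?_,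
    (norm_sub_le _ _).trans ?_⟩
  · rw [norm_pow, norm_pow]
    calc ‖y‖ ^ 2 + ‖x‖ ^ 2 ≤ (2 * κ) ^ 2 + (2 * κ) ^ 2 := by gcongr
      _ = _ := by ring
  · rw [norm_mul, norm_mul, norm_pow, norm_pow]
    calc ‖x‖ * ‖y‖ ^ 2 + ‖x‖ ^ 2 * ‖y‖ ≤ (2 * κ) * (2 * κ) ^ 2 + (2 * κ) ^ 2 * (2 * κ) := by gcongr
      _ = _ := by ring

theorem norm_wedge_leftVec_le (hc0 : 0 ≤ c) (hc1 : c < 1) (hκ1 : 10 ≤ κ) (hκ : ‖lam‖ = κ ^ 2)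
    (hx : ‖x‖ ≤ 2 * κ) (hy : ‖y‖ ≤ 2 * κ) :
    ‖wedge (leftVec c lam x) (leftVec c lam y) 2‖ ≤ 18 * κ ^ 3 ∧
      ‖wedge (leftVec c lam x) (leftVec c lam y) 4‖ ≤ 8 * κ ^ 2 ∧
      ‖wedge (leftVec c lam x) (leftVec c lam y) 5‖ ≤ 4 * κ := by
  have hκ0 : 0 < κ := by linarith
  have h0 : ∀ x : ℂ, ‖x‖ ≤ 2 * κ →
      ‖x ^ 3 - (1 - (c : ℂ) ^ 2) * x - 2 * lam * c‖ ≤ 9 * κ ^ 3 := by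
    intro x hx
    have h1 := norm_two_mul_mul_le hc0 hc1 hκ
    have h2 := mul_le_mul (norm_one_sub_sq_le hc0 hc1) hx (norm_nonneg x) zero_le_one
    have h3 : ‖x‖ ^ 3 ≤ (2 * κ) ^ 3 := by gcongr
    have h4 := norm_sub_le (x ^ 3 - (1 - (c : ℂ) ^ 2) * x) (2 * lam * c)
    have h5 := norm_sub_le (x ^ 3) ((1 - (c : ℂ) ^ 2) * x)
    rw [norm_pow, norm_mul] at h5
    have h6 : κ ^ 2 * 10 ≤ κ ^ 3 := by nlinarith [pow_pos hκ0 2]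
    have h7 : κ * 100 ≤ κ ^ 3 := by nlinarith
    nlinarith
  simp only [wedge, leftVec, cons_val, one_mul, mul_one]
  refine ⟨(norm_sub_le _ _).trans (by linarith [h0 x hx, h0 y hy]), ?_,
    (norm_sub_le _ _).trans (by linarith)⟩
  rw [sub_sub_sub_cancel_right]
  refine (norm_sub_le _ _).trans ?_
  rw [norm_pow, norm_pow]
  calc ‖x‖ ^ 2 + ‖y‖ ^ 2 ≤ (2 * κ) ^ 2 + (2 * κ) ^ 2 := by gcongr
    _ = _ := by ring

end RootBounds

theorem coord_mul_perturbation_mul_apply (c : ℝ) (lam p p' p'' : ℂ)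
    (T S : Matrix (Fin 6) (Fin 6) ℂ) (k m : Fin 6) :
    (T * (wedgeMatrix c lam p p' p'' - MWedgeInf c lam) * S) k m =
      T k 2 * (-(2 * p' * S 0 m) - p * S 1 m) + T k 4 * (p'' * S 0 m - p * S 3 m) +
        T k 5 * (p'' * S 1 m + 2 * p' * S 3 m) := by
  simp only [MWedgeInf, wedgeMatrix, mul_apply, Fin.sum_univ_six, Matrix.sub_apply, of_apply,
    cons_val]
  ring

/-- In the eigenbasis of `𝓜^∧_∞(λ)` the perturbation is of the order `|λ|^{-1/2}`. The terms with
`p`, `p'` and `p''` are of the orders `κ⁻¹`, `κ⁻²` and `κ⁻³`. -/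
theorem IsRootList.norm_coord_perturbation_le {c : ℝ} {lam : ℂ} {ρ : Fin 4 → ℂ}
    (h : IsRootList c lam ρ) (hc0 : 0 ≤ c) (hc1 : c < 1) {κ : ℝ} (hκ1 : 10 ≤ κ)
    (hκ : ‖lam‖ = κ ^ 2) {p p' p'' : ℂ} {q : ℝ} (hp : ‖p‖ ≤ q) (hp' : ‖p'‖ ≤ q) (hp'' : ‖p''‖ ≤ q)
    (k m : Fin 6) :
    ‖(eigenCoord c lam ρ * (wedgeMatrix c lam p p' p'' - MWedgeInf c lam) * eigenBasis ρ) k m‖ ≤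
      608 / κ * q := by
  have hκ0 : 0 < κ := by linarith
  have hq : 0 ≤ q := (norm_nonneg p).trans hp
  have hρ : ∀ i, ‖ρ i‖ ≤ 2 * κ := fun i => norm_root_le hc0 hc1 hκ1 hκ (h.isRoot i)
  have hd : ∀ i, κ ^ 3 ≤ ‖charDeriv c lam (ρ i)‖ := fun i =>
    le_norm_charDeriv hc0 hc1 hκ1 hκ (h.isRoot i)
  obtain ⟨s0, s1, s3⟩ := norm_wedge_rightVec_le (hρ (pairFst m)) (hρ (pairSnd m))
  obtain ⟨t2, t4, t5⟩ := norm_wedge_leftVec_le hc0 hc1 hκ1 hκ (hρ (pairFst k)) (hρ (pairSnd k))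
  have hdd : ‖(charDeriv c lam (ρ (pairFst k)) * charDeriv c lam (ρ (pairSnd k)))⁻¹‖ ≤
      (κ ^ 6)⁻¹ := by
    rw [norm_inv, norm_mul]
    refine inv_anti₀ (by positivity) ?_
    calc κ ^ 6 = κ ^ 3 * κ ^ 3 := by ring
      _ ≤ _ := mul_le_mul (hd _) (hd _) (by positivity) (norm_nonneg _)
  have hT : ∀ j (C : ℝ), ‖wedge (leftVec c lam (ρ (pairFst k))) (leftVec c lam (ρ (pairSnd k))) j‖
      ≤ C → ‖eigenCoord c lam ρ k j‖ ≤ (κ ^ 6)⁻¹ * C := fun j C hC => by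
    rw [eigenCoord, of_apply, norm_mul]
    exact mul_le_mul hdd hC (norm_nonneg _) (by positivity)
  have T2 := hT _ _ t2
  have T4 := hT _ _ t4
  have T5 := hT _ _ t5
  rw [coord_mul_perturbation_mul_apply]
  change ‖eigenBasis ρ 0 m‖ ≤ _ at s0
  change ‖eigenBasis ρ 1 m‖ ≤ _ at s1
  change ‖eigenBasis ρ 3 m‖ ≤ _ at s3
  refine (norm_add₃_le).trans ?_
  simp only [norm_mul]
  have B2 : ‖-(2 * p' * eigenBasis ρ 0 m) - p * eigenBasis ρ 1 m‖ ≤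
      2 * q * (4 * κ) + q * (8 * κ ^ 2) := by
    refine (norm_sub_le _ _).trans ?_
    rw [norm_neg, norm_mul, norm_mul, norm_mul, Complex.norm_two]
    gcongr
  have B4 : ‖p'' * eigenBasis ρ 0 m - p * eigenBasis ρ 3 m‖ ≤
      q * (4 * κ) + q * (16 * κ ^ 3) := by
    refine (norm_sub_le _ _).trans ?_
    rw [norm_mul, norm_mul]
    gcongr
  have B5 : ‖p'' * eigenBasis ρ 1 m + 2 * p' * eigenBasis ρ 3 m‖ ≤
      q * (8 * κ ^ 2) + 2 * q * (16 * κ ^ 3) := by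
    refine (norm_add_le _ _).trans ?_
    rw [norm_mul, norm_mul, norm_mul, Complex.norm_two]
    gcongr
  calc _ ≤ (κ ^ 6)⁻¹ * (18 * κ ^ 3) * (2 * q * (4 * κ) + q * (8 * κ ^ 2)) +
        (κ ^ 6)⁻¹ * (8 * κ ^ 2) * (q * (4 * κ) + q * (16 * κ ^ 3)) +
        (κ ^ 6)⁻¹ * (4 * κ) * (q * (8 * κ ^ 2) + 2 * q * (16 * κ ^ 3)) := by gcongr
    _ = (272 * κ ^ 5 + 272 * κ ^ 4 + 64 * κ ^ 3) / κ ^ 6 * q := by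
        rw [div_eq_mul_inv]
        ring
    _ ≤ (608 * κ ^ 5) / κ ^ 6 * q := by
        have h1 : κ ^ 4 ≤ κ ^ 5 := pow_le_pow_right₀ (by linarith) (by norm_num)
        have h2 : κ ^ 3 ≤ κ ^ 5 := pow_le_pow_right₀ (by linarith) (by norm_num)
        gcongr
        linarith
    _ = _ := by
        field_simp

/-! ### Decay of the profile -/

/-- A bound, up to a constant factor, for the profile and its first two derivatives. -/
noncomputable def profileBound (c ζ : ℝ) : ℝ :=
  (1 + (Real.sqrt (1 - c ^ 2) * ζ) ^ 2)⁻¹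

theorem profileBound_nonneg (c ζ : ℝ) : 0 ≤ profileBound c ζ := by
  unfold profileBound
  positivity

theorem profileBound_neg (c ζ : ℝ) : profileBound c (-ζ) = profileBound c ζ := by
  simp [profileBound]

theorem integrable_profileBound {c : ℝ} (hc0 : 0 ≤ c) (hc1 : c < 1) :
    Integrable (profileBound c) :=
  integrable_inv_one_add_sq.comp_mul_left' (Real.sqrt_pos.2 (by nlinarith)).ne'

theorem one_add_sq_le_cosh_sq (x : ℝ) : 1 + x ^ 2 ≤ Real.cosh x ^ 2 := by
  rw [Real.cosh_sq' x]
  have h : |x| ≤ |Real.sinh x| := by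
    rw [Real.abs_sinh]
    exact Real.self_le_sinh_iff.2 (abs_nonneg x)
  linarith [sq_le_sq.2 h]

theorem deriv_p0 (c : ℝ) : deriv (p0 c) = fun ζ =>
    -(12 * (1 - c ^ 2) * √(1 - c ^ 2)) * Real.sinh (√(1 - c ^ 2) * ζ) /
      Real.cosh (√(1 - c ^ 2) * ζ) ^ 3 := by
  funext ζ
  have hne := (Real.cosh_pos (√(1 - c ^ 2) * ζ)).ne'
  have h1 := ((hasDerivAt_id ζ).const_mul √(1 - c ^ 2)).cosh
  have h2 := (hasDerivAt_const ζ (6 * (1 - c ^ 2))).div (h1.pow 2) (pow_ne_zero 2 hne)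
  refine h2.deriv.trans ?_
  simp
  field_simp
  ring

theorem deriv_deriv_p0 (c : ℝ) : deriv (deriv (p0 c)) = fun ζ =>
    -(12 * (1 - c ^ 2) * √(1 - c ^ 2) ^ 2) * (Real.cosh (√(1 - c ^ 2) * ζ) ^ 2 -
      3 * Real.sinh (√(1 - c ^ 2) * ζ) ^ 2) / Real.cosh (√(1 - c ^ 2) * ζ) ^ 4 := by
  rw [deriv_p0]
  funext ζ
  have hne := (Real.cosh_pos (√(1 - c ^ 2) * ζ)).ne'
  have h1 := ((hasDerivAt_id ζ).const_mul √(1 - c ^ 2)).cosh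
  have h2 := ((hasDerivAt_id ζ).const_mul √(1 - c ^ 2)).sinh
  have h3 := (h2.const_mul (-(12 * (1 - c ^ 2) * √(1 - c ^ 2)))).div (h1.pow 3)
    (pow_ne_zero 3 hne)
  refine h3.deriv.trans ?_
  simp
  field_simp
  ring

theorem abs_profile_le {c : ℝ} (hc0 : 0 ≤ c) (hc1 : c < 1) (ζ : ℝ) :
    |p0 c ζ| ≤ 48 * profileBound c ζ ∧ |deriv (p0 c) ζ| ≤ 48 * profileBound c ζ ∧
      |deriv (deriv (p0 c)) ζ| ≤ 48 * profileBound c ζ := by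
  rw [deriv_deriv_p0, deriv_p0, p0, profileBound]
  have hA0 : 0 < 1 - c ^ 2 := by nlinarith
  have hA1 : 1 - c ^ 2 ≤ 1 := by nlinarith
  have ha0 : 0 ≤ √(1 - c ^ 2) := Real.sqrt_nonneg _
  have ha1 : √(1 - c ^ 2) ≤ 1 := Real.sqrt_le_one.2 hA1
  set A := 1 - c ^ 2
  set a := √A
  set t := a * ζ
  have hC : 0 < Real.cosh t := Real.cosh_pos t
  have hS : |Real.sinh t| ≤ Real.cosh t := by
    refine abs_le_of_sq_le_sq ?_ hC.le
    linarith [Real.cosh_sq t]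
  have hS2 : Real.sinh t ^ 2 ≤ Real.cosh t ^ 2 := by linarith [Real.cosh_sq t]
  have hb : 48 / Real.cosh t ^ 2 ≤ 48 * (1 + t ^ 2)⁻¹ := by
    rw [div_eq_mul_inv]
    gcongr
    exact one_add_sq_le_cosh_sq t
  refine ⟨le_trans ?_ hb, le_trans ?_ hb, le_trans ?_ hb⟩
  · rw [abs_div, abs_of_pos (by positivity : 0 < 6 * A), abs_of_pos (pow_pos hC 2)]
    gcongr
    linarith
  · rw [abs_div, abs_mul, abs_neg, abs_of_nonneg (by positivity : 0 ≤ 12 * A * a),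
      abs_of_pos (pow_pos hC 3)]
    calc 12 * A * a * |Real.sinh t| / Real.cosh t ^ 3
        ≤ 12 * 1 * 1 * Real.cosh t / Real.cosh t ^ 3 := by gcongr
      _ = 12 / Real.cosh t ^ 2 := by field_simp
      _ ≤ _ := by gcongr; norm_num
  · rw [abs_div, abs_mul, abs_neg, abs_of_nonneg (by positivity : 0 ≤ 12 * A * a ^ 2),
      abs_of_pos (pow_pos hC 4)]
    have h1 : |Real.cosh t ^ 2 - 3 * Real.sinh t ^ 2| ≤ 4 * Real.cosh t ^ 2 := by
      rw [abs_le]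
      constructor <;> nlinarith [sq_nonneg (Real.sinh t)]
    calc 12 * A * a ^ 2 * |Real.cosh t ^ 2 - 3 * Real.sinh t ^ 2| / Real.cosh t ^ 4
        ≤ 12 * 1 * 1 ^ 2 * (4 * Real.cosh t ^ 2) / Real.cosh t ^ 4 := by gcongr
      _ = 48 / Real.cosh t ^ 2 := by field_simp; norm_num

theorem continuous_MWedge (c : ℝ) (lam : ℂ) : Continuous (MWedge c lam) := by
  have hC : ∀ ζ, Real.cosh (√(1 - c ^ 2) * ζ) ≠ 0 := fun ζ => (Real.cosh_pos _).ne'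
  have h0 : Continuous (p0 c) := by
    unfold p0
    exact continuous_const.div (by fun_prop) fun ζ => pow_ne_zero 2 (hC ζ)
  have h1 : Continuous (deriv (p0 c)) := by
    rw [deriv_p0]
    exact Continuous.div (by fun_prop) (by fun_prop) fun ζ => pow_ne_zero 3 (hC ζ)
  have h2 : Continuous (deriv (deriv (p0 c))) := by
    rw [deriv_deriv_p0]
    exact Continuous.div (by fun_prop) (by fun_prop) fun ζ => pow_ne_zero 4 (hC ζ)
  refine continuous_matrix fun i j => ?_
  fin_cases i <;> fin_cases j <;> simp [MWedge, wedgeMatrix] <;> fun_prop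

/-! ### Comparison of the Evans function with the product of eigenvectors -/

/-- Reflection and transposition turn the equation for `z^∧` into one of the type of that for
`y^∧`. -/
theorem isZWedge_iff_comp_neg {c : ℝ} {lam : ℂ} {l : Fin 6 → ℂ} {z : ℝ → Fin 6 → ℂ} :
    IsZWedge c lam l z ↔
      (∀ ζ, HasDerivAt (fun x => z (-x))
        (((MWedgeInf c lam)ᵀ + (MWedge c lam (-ζ) - MWedgeInf c lam)ᵀ) *ᵥ z (-ζ)) ζ) ∧
      Tendsto (fun ζ : ℝ => Complex.exp (-(muWedge c lam * ζ)) • z (-ζ)) atTop (𝓝 l) := by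
  have e : ∀ ζ, ((MWedgeInf c lam)ᵀ + (MWedge c lam (-ζ) - MWedgeInf c lam)ᵀ) *ᵥ z (-ζ) =
      z (-ζ) ᵥ* MWedge c lam (-ζ) := fun ζ => by
    rw [← transpose_add, add_sub_cancel, mulVec_transpose]
  simp only [e]
  refine and_congr ⟨fun h ζ => ?_, fun h ζ => ?_⟩ ?_
  · have := (h (-ζ)).scomp ζ (hasDerivAt_neg ζ)
    exact this.congr_deriv (by simp)
  · have h1 := h (-ζ)
    rw [neg_neg] at h1
    have h2 := HasDerivAt.scomp (g₁ := fun x => z (-x)) ζ h1 (hasDerivAt_neg ζ)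
    have h3 : (fun x => z (-x)) ∘ (fun x : ℝ => -x) = z := by
      funext x
      simp
    have h4 := h3 ▸ h2
    exact h4.congr_deriv (by simp)
  · rw [← tendsto_comp_neg_atTop_iff]
    simp

/-- For vectors close to multiples of the same basis vector the product is close to that of the
multiples. -/
theorem norm_dotProduct_sub_mul_le {ι : Type*} [Fintype ι] [DecidableEq ι] {u v : ι → ℂ}
    {α β : ℂ} {η : ℝ} (k : ι) (hη0 : 0 ≤ η) (hη1 : η ≤ 1)
    (hu : ‖u - Pi.single k α‖ ≤ η * ‖α‖) (hv : ‖v - Pi.single k β‖ ≤ η * ‖β‖) :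
    ‖u ⬝ᵥ v - α * β‖ ≤ (2 + Fintype.card ι) * η * ‖α * β‖ := by
  set d := u - Pi.single k α with hd
  set e := v - Pi.single k β with he
  have hu' : u = Pi.single k α + d := by rw [hd]; abel
  have hv' : v = Pi.single k β + e := by rw [he]; abel
  have h1 : u ⬝ᵥ v - α * β = α * e k + d k * β + d ⬝ᵥ e := by
    rw [hu', hv', add_dotProduct, dotProduct_add, dotProduct_add, single_dotProduct,
      single_dotProduct, dotProduct_single, Pi.single_eq_same]
    ring
  have h2 : ‖α * e k‖ ≤ ‖α‖ * (η * ‖β‖) := by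
    rw [norm_mul]
    gcongr
    exact (norm_le_pi_norm e k).trans hv
  have h3 : ‖d k * β‖ ≤ η * ‖α‖ * ‖β‖ := by
    rw [norm_mul]
    gcongr
    exact (norm_le_pi_norm d k).trans hu
  have h4 : ‖d ⬝ᵥ e‖ ≤ Fintype.card ι * (η * ‖α‖ * (1 * ‖β‖)) := by
    calc ‖∑ i, d i * e i‖ ≤ ∑ _i : ι, η * ‖α‖ * (1 * ‖β‖) := by
          refine norm_sum_le_of_le _ fun i _ => ?_
          rw [norm_mul]
          refine mul_le_mul ((norm_le_pi_norm d i).trans hu)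
            (((norm_le_pi_norm e i).trans hv).trans ?_) (norm_nonneg _) (by positivity)
          gcongr
      _ = _ := by simp
  rw [h1, norm_mul α]
  refine norm_add₃_le.trans ?_
  linarith

/-- For large `|λ|` the relative error of `l^∧ · r^∧` as an approximation of the Evans function is
of the order `|λ|^{-1/2}`. The denominator does not vanish, as `μ^∧` is a simple eigenvalue. -/
theorem exists_norm_evansHat_sub_le {c : ℝ} (hc0 : 0 ≤ c) (hc1 : c < 1) :
    ∃ K R : ℝ, ∀ (lam : ℂ) (l r : Fin 6 → ℂ), 0 < lam.re → R ≤ √‖lam‖ →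
      IsLeftEigenvector c lam l → IsRightEigenvector c lam r →
      l ⬝ᵥ r ≠ 0 ∧ ‖evansHat c lam l r - l ⬝ᵥ r‖ ≤ K / √‖lam‖ * ‖l ⬝ᵥ r‖ := by
  set G : ℝ := ∫ s, profileBound c s with hG
  have hG0 : 0 ≤ G := integral_nonneg (profileBound_nonneg c)
  set Q : ℝ := 6 * (608 * 48 * G) with hQ
  have hQ0 : 0 ≤ Q := by positivity
  -- `Q / κ` is the total size of the perturbation; `κ ≥ 2 Q` makes it at most `1 / 2`, and the
  -- factor `16 = 2 * (2 + 6)` comes from `norm_dotProduct_sub_mul_le` with `η = 2 Q / κ`.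
  refine ⟨16 * Q, max 10 (2 * Q), fun lam l r hlam hR hl hr => ?_⟩
  set κ := √‖lam‖ with hκdef
  have hκ10 : 10 ≤ κ := (le_max_left _ _).trans hR
  have hκQ : 2 * Q ≤ κ := (le_max_right _ _).trans hR
  have hκ0 : 0 < κ := by linarith
  have hκ : ‖lam‖ = κ ^ 2 := (Real.sq_sqrt (norm_nonneg lam)).symm
  obtain ⟨ρ, hρ⟩ := exists_isRootList (c := c) (lam := lam) fun x hx h0 => by
    have := le_norm_charDeriv hc0 hc1 hκ10 hκ hx
    rw [h0, norm_zero] at this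
    exact absurd this (not_le.2 (by positivity))
  set S := eigenBasis ρ with hS
  set T := eigenCoord c lam ρ with hT
  have hTS : T * S = 1 := hρ.eigenCoord_mul_eigenBasis
  have hST : S * T = 1 := mul_eq_one_comm.1 hTS
  have hAS : MWedgeInf c lam * S = S * diagonal (pairSum ρ) := hρ.MWedgeInf_mul_eigenBasis
  have hTA : T * MWedgeInf c lam = diagonal (pairSum ρ) * T :=
    coord_mul_eq_diagonal_mul_coord hTS hAS
  have hTS' : Sᵀ * Tᵀ = 1 := by rw [← transpose_mul, hTS, transpose_one]
  have hAS' : (MWedgeInf c lam)ᵀ * Tᵀ = Tᵀ * diagonal (pairSum ρ) := by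
    rw [← transpose_mul, hTA, transpose_mul, diagonal_transpose]
  have hν : ∀ k, (muWedge c lam).re ≤ (pairSum ρ k).re := fun k =>
    hρ.re_muWedge_le (pairFst_ne_pairSnd k)
  -- The integrable majorant of the perturbation in eigencoordinates.
  set b : ℝ → ℝ := fun s => 608 / κ * (48 * profileBound c s) with hb
  have hbi : Integrable b := ((integrable_profileBound hc0 hc1).const_mul _).const_mul _
  have hb0 : ∀ s, 0 ≤ b s := fun s => by
    have := profileBound_nonneg c s
    positivity
  have hδ : (Fintype.card (Fin 6) : ℝ) * ∫ s, b s = Q / κ := by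
    rw [hb, integral_const_mul, integral_const_mul, ← hG, Fintype.card_fin, hQ]
    push_cast
    ring
  have hδ2 : Q / κ ≤ 1 / 2 := by
    rw [div_le_iff₀ hκ0]
    linarith
  have hPb : ∀ s i j, ‖(T * (MWedge c lam s - MWedgeInf c lam) * S) i j‖ ≤ b s := by
    intro s i j
    obtain ⟨h1, h2, h3⟩ := abs_profile_le hc0 hc1 s
    refine hρ.norm_coord_perturbation_le hc0 hc1 hκ10 hκ ?_ ?_ ?_ i j <;>
      rwa [Complex.norm_real, Real.norm_eq_abs]
  have hPb' : ∀ s i j, ‖(Sᵀ * (MWedge c lam (-s) - MWedgeInf c lam)ᵀ * Tᵀ) i j‖ ≤ b s := by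
    intro s i j
    have h1 := hPb (-s) j i
    rw [← transpose_mul, ← transpose_mul, transpose_apply, ← Matrix.mul_assoc]
    simpa only [hb, profileBound_neg] using h1
  have hM := continuous_MWedge c lam
  have hPc : Continuous fun s => MWedge c lam s - MWedgeInf c lam := hM.sub continuous_const
  have hPc' : Continuous fun s => (MWedge c lam (-s) - MWedgeInf c lam)ᵀ :=
    ((hM.comp continuous_neg).sub continuous_const).matrix_transpose
  have hl' : (MWedgeInf c lam)ᵀ *ᵥ l = muWedge c lam • l := by
    rw [mulVec_transpose]
    exact hl.2
  have ey : ∀ (y : ℝ → Fin 6 → ℂ) ζ, (MWedgeInf c lam + (MWedge c lam ζ - MWedgeInf c lam)) *ᵥ y ζ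
      = MWedge c lam ζ *ᵥ y ζ := fun y ζ => by rw [add_sub_cancel]
  -- The Evans function is formed from genuine solutions.
  have hy : IsYWedge c lam r (yWedge c lam r) := by
    have hex : ∃ y, IsYWedge c lam r y := by
      obtain ⟨y, h1, h2⟩ := exists_solution_tendsto_eigenvector hTS hAS hν hPc hbi hb0 hPb
        (hδ.trans_le hδ2) hr.2
      exact ⟨y, fun ζ => ey y ζ ▸ h1 ζ, h2⟩
    rw [yWedge, dif_pos hex]
    exact hex.choose_spec
  have hz : IsZWedge c lam l (zWedge c lam l) := by
    have hex : ∃ z, IsZWedge c lam l z := by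
      obtain ⟨w, h1, h2⟩ := exists_solution_tendsto_eigenvector hTS' hAS' hν hPc' hbi hb0 hPb'
        (hδ.trans_le hδ2) hl'
      refine ⟨fun ζ => w (-ζ), isZWedge_iff_comp_neg.2 ?_⟩
      simp only [neg_neg]
      exact ⟨h1, h2⟩
    rw [zWedge, dif_pos hex]
    exact hex.choose_spec
  have hz' := isZWedge_iff_comp_neg.1 hz
  have by0 := norm_coord_zero_sub_le hTS hAS hν hPc hbi hb0 hPb (hδ.trans_le hδ2) hr.2
    (fun ζ => (ey _ ζ).symm ▸ hy.1 ζ) hy.2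
  have bz0 := norm_coord_zero_sub_le hTS' hAS' hν hPc' hbi hb0 hPb' (hδ.trans_le hδ2) hl'
    hz'.1 hz'.2
  rw [neg_zero] at bz0
  rw [hδ] at by0 bz0
  -- By simplicity of `μ^∧` the eigenvectors have a single nonzero coordinate, the same for both.
  have hcr := sub_mul_coord_eq_zero hTS hAS hr.2
  have hcl := sub_mul_coord_eq_zero hTS' hAS' hl'
  have hTr : T *ᵥ r ≠ 0 := fun h => hr.1 (by
    rw [← one_mulVec r, ← hST, ← mulVec_mulVec, h, mulVec_zero])
  have hSl : Sᵀ *ᵥ l ≠ 0 := fun h => hl.1 (by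
    rw [← one_mulVec l, ← mul_eq_one_comm.1 hTS', ← mulVec_mulVec, h, mulVec_zero])
  obtain ⟨k, hk⟩ := Function.ne_iff.1 hTr
  obtain ⟨m, hm⟩ := Function.ne_iff.1 hSl
  have hkμ : pairSum ρ k = muWedge c lam :=
    sub_eq_zero.1 ((mul_eq_zero.1 (hcr k)).resolve_right hk)
  have hmμ : pairSum ρ m = muWedge c lam :=
    sub_eq_zero.1 ((mul_eq_zero.1 (hcl m)).resolve_right hm)
  obtain rfl : k = m := hρ.eq_of_pairSum_eq_muWedge hlam hkμ hmμ
  have hsingle : ∀ v : Fin 6 → ℂ, (∀ j, (pairSum ρ j - muWedge c lam) * v j = 0) →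
      v = Pi.single k (v k) := by
    intro v hv
    funext j
    by_cases hj : j = k
    · subst hj
      simp
    · rw [Pi.single_eq_of_ne hj]
      refine (mul_eq_zero.1 (hv j)).resolve_left fun h => hj ?_
      exact hρ.eq_of_pairSum_eq_muWedge hlam (sub_eq_zero.1 h) hkμ
  have hdot : ∀ v w : Fin 6 → ℂ, v ⬝ᵥ w = (Sᵀ *ᵥ v) ⬝ᵥ (T *ᵥ w) := fun v w => by
    rw [mulVec_transpose, ← dotProduct_mulVec, mulVec_mulVec, hST, one_mulVec]
  set α := (Sᵀ *ᵥ l) k with hα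
  set β := (T *ᵥ r) k with hβ
  have hlr : l ⬝ᵥ r = α * β := by
    rw [hdot, hsingle _ hcr, hsingle _ hcl, single_dotProduct, Pi.single_eq_same]
  rw [hsingle _ hcr, Pi.norm_single] at by0
  rw [hsingle _ hcl, Pi.norm_single] at bz0
  refine ⟨hlr ▸ mul_ne_zero hm hk, ?_⟩
  rw [evansHat, hdot, hlr]
  refine (norm_dotProduct_sub_mul_le (η := 2 * (Q / κ)) k (by positivity) (by linarith) bz0
    by0).trans (le_of_eq ?_)
  rw [Fintype.card_fin]
  push_cast
  ring

end ElasticaLoop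

theorem theorem4p2 (c : ℝ) (hc0 : 0 ≤ c) (hc1 : c < 1) (l r : ℂ → Fin 6 → ℂ)
    (hl : ∀ lam : ℂ, 0 < lam.re → ElasticaLoop.IsLeftEigenvector c lam (l lam))
    (hr : ∀ lam : ℂ, 0 < lam.re → ElasticaLoop.IsRightEigenvector c lam (r lam)) :
    Tendsto (fun lam => ElasticaLoop.evansHat c lam (l lam) (r lam) / (l lam ⬝ᵥ r lam))
        ElasticaLoop.atInftyRight (𝓝 1) ∧
      ((∃ C : ℝ, ∀ᶠ lam in ElasticaLoop.atInftyRight, ‖l lam ⬝ᵥ r lam‖ ≤ C) →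
        Tendsto (fun lam => ElasticaLoop.evansHat c lam (l lam) (r lam) - l lam ⬝ᵥ r lam)
          ElasticaLoop.atInftyRight (𝓝 0)) := by
  obtain ⟨K, R, hKR⟩ := ElasticaLoop.exists_norm_evansHat_sub_le hc0 hc1
  have hsqrt : Tendsto (fun lam : ℂ => √‖lam‖) ElasticaLoop.atInftyRight atTop :=
    Real.tendsto_sqrt_atTop.comp (tendsto_norm_cobounded_atTop.mono_left inf_le_left)
  have hre : ∀ᶠ lam : ℂ in ElasticaLoop.atInftyRight, 0 < lam.re :=
    mem_inf_of_right (mem_principal_self _)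
  have hev : ∀ᶠ lam in ElasticaLoop.atInftyRight, l lam ⬝ᵥ r lam ≠ 0 ∧
      ‖ElasticaLoop.evansHat c lam (l lam) (r lam) - l lam ⬝ᵥ r lam‖ ≤
        K / √‖lam‖ * ‖l lam ⬝ᵥ r lam‖ := by
    filter_upwards [hre, hsqrt.eventually_ge_atTop R] with lam h1 h2
    exact hKR lam _ _ h1 h2 (hl lam h1) (hr lam h1)
  have hlim : Tendsto (fun lam : ℂ => K / √‖lam‖) ElasticaLoop.atInftyRight (𝓝 0) :=
    hsqrt.const_div_atTop K
  refine ⟨?_, fun ⟨C, hC⟩ => ?_⟩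
  · rw [tendsto_iff_norm_sub_tendsto_zero]
    refine squeeze_zero' (Eventually.of_forall fun _ => norm_nonneg _) ?_ hlim
    filter_upwards [hev] with lam h
    rw [div_sub_one h.1, norm_div, div_le_iff₀ (norm_pos_iff.2 h.1)]
    exact h.2
  · have hlim' : Tendsto (fun lam : ℂ => |K / √‖lam‖| * C) ElasticaLoop.atInftyRight (𝓝 0) := by
      simpa using hlim.abs.mul_const C
    refine squeeze_zero_norm' ?_ hlim'
    filter_upwards [hev, hC] with lam h h'
    refine h.2.trans ?_
    gcongr
    exact le_abs_self _
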